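/- **Setting.** Let $n$ followers $1,\dots,n$ and $m$ leaders $n+1,\dots,n+m$ be the nodes of a fixed weighted directed graph with adjacency matrix $[a_{uv}]$, $a_{uv}\ge 0$, $a_{uu}=0$, where $a_{uv}>0$ iff there is an edge from $v$ to $u$; leaders have no incoming edges. The followers obey $\dot x_i=A_ix_i+B_iu_i$, $y_i=C_ix_i\in\mathbb R^Q$ ($x_i\in\mathbb R^{N_i}$, $u_i\in\mathbb R^{P_i}$) and the leaders obey $\dot\omega_k=S_k\omega_k$, $y_k=D_k\omega_k\in\mathbb R^Q$ ($\omega_k\in\mathbb R^q$). A real square matrix is Hurwitz if all its eigenvalues have negative real part. The Laplacian $\mathcal L$ ($\ell_{uu}=\sum_v a_{uv}$, $\ell_{uv}=-a_{uv}$ for $u\neq v$) has the blocks $\mathcal L_1$ (followers–followers) and $\mathcal L_2$ (followers–leaders), and $\Phi=[\varphi_{ik}]=-\mathcal L_1^{-1}\mathcal L_2$. For a follower $i$, let $N_i^L$ be the set of its leader neighbors, $N_i^F$ the set of its follower neighbors, $\bar N_i^A$ the set consisting of $i$ and all followers with a directed path to $i$, $\bar N_i^L$ the set of all leaders with a directed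 path to $i$, and $\bar{\mathcal E}_i$ the set of all weighted edges $((t,v),a_{tv})$ with $t\in\bar N_i^A$ and $a_{tv}>0$. Index sets are ordered by label. Let $\Phi^i=[\varphi_{ik}]_{k\in\bar N_i^L}$ (a row), $\bar{\bar S}_i=\mathrm{diag}(S_k)_{k\in\bar N_i^L}$, $\bar{\bar D}_i=\mathrm{diag}(D_k)_{k\in\bar N_i^L}$, $\Omega_i=\mathrm{col}(\omega_k)_{k\in\bar N_i^L}$, $\Omega=\mathrm{col}(\Omega_1,\dots,\Omega_n)$. **Assumptions.** (a) Every follower is reached by a directed path from some leader; (b) the graph is acyclic; (c) agents carry distinct labels that reveal whether they are leaders or followers; (d) every $(A_i,B_i)$ is stabilizable and every $C_i$ has full row rank; (e) every $S_k$ is marginally stable (all eigenvalues have nonpositive real part and those on the imaginary axis are semisimple); (f) for every follower $i$ the regulator equations $$\Pi_i\bar{\bar S}_i=A_i\Pi_i+B_i\Gamma_i,\qquad 0=C_i\Pi_i-(\Phi^i\otimes I_Q)\bar{\bar D}_i$$ have a solution $(\Pi_i,\Gamma_i)$. **Algorithms.** *Algorithm 1:* with $N_i^A=\{i\}\cup N_i^F$,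 put $\bar N_i^{L(0)}=N_i^L$, $\bar N_i^{A(0)}=N_i^A$, and for $k\ge1$ $\bar N_i^{L(k)}=N_i^L\cup\bigcup_{j\in N_i^F}\bar N_j^{L(k-1)}$, $\bar N_i^{A(k)}=N_i^A\cup\bigcup_{j\in N_i^F}\bar N_j^{A(k-1)}$; follower $i$ stops at $k$ when its own two sets did not grow in step $k$ and those of every $j\in N_i^F$ did not grow in step $k-1$. *Algorithm 2:* the same iteration and stopping rule for sets of weighted edges, starting from $\bar{\mathcal E}_i^{(0)}=\{((i,v),a_{iv}):a_{iv}>0\}$. *Algorithm 3:* from the sets returned by Algorithms 1 and 2, follower $i$ forms the matrices of recorded weights $\bar{\mathcal A}^i$ (followers–followers) and $\bar{\mathcal A}_2^i$ (followers–leaders), with entry $0$ for unrecorded pairs, the diagonal matrix $\bar{\mathcal D}^i$ of the row sums of $[\bar{\mathcal A}^i\ \bar{\mathcal A}_2^i]$, and returns $-\Upsilon_i(\bar{\mathcal D}^i-\bar{\mathcal A}^i)^{-1}(-\bar{\mathcal A}_2^i)$, where $\Upsilon_i$ is the row that selects follower $i$. **Protocol.** Let $K_i^1$ be such that $A_i+B_iK_i^1$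 is Hurwitz, let $(\Pi_i,\Gamma_i)$ be any solution of the regulator equations, $K_i^2=\Gamma_i-K_i^1\Pi_i$, and $u_i=K_i^1x_i+K_i^2\eta_i$ with $\eta_i=\mathrm{col}(\eta_i^k)_{k\in\bar N_i^L}$, where for $k\in\bar N_i^L$ $$\dot\eta_i^k=S_i^k\eta_i^k+\beta^\eta\Big(\sum_{j\in N_i^F}a_{ij}(\eta_j^{k}-\eta_i^k)+a_{ik}(\omega_k-\eta_i^k)\Big),$$ $$\dot S_i^k=\beta^S\Big(\sum_{j\in N_i^F}a_{ij}(S_j^{k}-S_i^k)+a_{ik}(S_k-S_i^k)\Big),\qquad \dot D_i^k=\beta^D\Big(\sum_{j\in N_i^F}a_{ij}(D_j^{k}-D_i^k)+a_{ik}(D_k-D_i^k)\Big),$$ and, for $j$ with $k\notin\bar N_j^L$, the symbols $\eta_j^k,S_j^k,D_j^k$ are read as $\eta_i^k,S_i^k,D_i^k$. **Closed-loop matrices.** For a leader $k$ let $\bar N_k^S=\{i:k\in\bar N_i^L\}$ and let $H_k$ be the Laplacian of the subgraph on the followers in $\bar N_k^S$ plus $\mathrm{diag}(a_{ik})_{i\in\bar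 N_k^S}$. Let $\Theta=\mathrm{diag}_k(I\otimes S_k-\beta^\eta H_k\otimes I_q)$, $\bar\Theta=\mathrm{diag}_k(\beta^\eta H_k\otimes I_q)$, and let $\Theta',\bar\Theta'$ be these matrices after the permutation that regroups the coordinates $(k,i)$ by followers, in the order of $\eta=\mathrm{col}(\eta_1,\dots,\eta_n)$. With $A=\mathrm{diag}(A_i)$, and $B,C,K^1,K^2$ likewise, put $$A_C=\begin{bmatrix}A+BK^1&BK^2\\0&\Theta'\end{bmatrix},\quad B_C=\begin{bmatrix}0\\ \bar\Theta'\end{bmatrix},\quad C_C=[\,C\ \ 0\,],\quad D_C=-\mathrm{diag}_i\big((\Phi^i\otimes I_Q)\bar{\bar D}_i\big).$$ **Theorem 3.** Under assumptions (a)–(f), for all such $K_i^1,\Pi_i,\Gamma_i,K_i^2$ and all $\beta^\eta,\beta^S,\beta^D>0$: 1. For every follower $i$, Algorithms 1 and 2 stop and return $\bar N_i^A$, $\bar N_i^L$ and $\bar{\mathcal E}_i$; the matrix inverted in Algorithm 3 is invertible and Algorithm 3 returns $\Phi^i$. 2. $A_C$ is Hurwitz. 3. For all solutions on $[0,\infty)$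 of $\dot\Omega=\mathrm{diag}(\bar{\bar S}_1,\dots,\bar{\bar S}_n)\,\Omega$, $\dot X_C=A_CX_C+B_C\Omega$ (the closed loop in which the estimates $S_i^k,D_i^k$ equal $S_k,D_k$), $E=C_CX_C+D_C\Omega$ satisfies $\lim_{t\to\infty}E(t)=0$. 4. For every solution on $[0,\infty)$ of the full closed loop of leaders, followers, control law and adaptive observer, with arbitrary initial conditions, the stacked containment error $E=C_C\,\mathrm{col}(x_1,\dots,x_n,\eta)+D_C\Omega$, whose $i$-th block is $y_i-(\Phi^i\otimes I_Q)\bar{\bar D}_i\Omega_i$, satisfies $\lim_{t\to\infty}E(t)=0$. Consequently, for every follower $i$, $y_i(t)-\sum_k\varphi_{ik}y_k(t)\to0$ (sum over all leaders), and the Euclidean distance of $y_i(t)$ to the convex hull of the leader outputs $\{y_k(t)\}$ tends to $0$. -/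

import Mathlib

open Matrix Filter Topology
open scoped Kronecker

noncomputable section

/-! ### Matrices -/

/-- A real square matrix is Hurwitz if all its (complex) eigenvalues have negative real part. -/
def IsHurwitz {ι : Type*} [Fintype ι] [DecidableEq ι] (A : Matrix ι ι ℝ) : Prop :=
  ∀ z ∈ spectrum ℂ (A.map (algebraMap ℝ ℂ)), z.re < 0

/-- Marginal stability of `x' = S x`: all eigenvalues lie in the closed left half plane, and those
on the imaginary axis are semisimple. -/
def IsMarginallyStable {ι : Type*} [Fintype ι] [DecidableEq ι] (S : Matrix ι ι ℝ) : Prop :=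
  ∀ z ∈ spectrum ℂ (S.map (algebraMap ℝ ℂ)), z.re ≤ 0 ∧
    (z.re = 0 → ∀ v : ι → ℂ,
      (S.map (algebraMap ℝ ℂ) - z • (1 : Matrix ι ι ℂ)) ^ 2 *ᵥ v = 0 →
      (S.map (algebraMap ℝ ℂ) - z • (1 : Matrix ι ι ℂ)) *ᵥ v = 0)

/-- `(A, B)` is stabilizable. -/
def IsStabilizable {ι κ : Type*} [Fintype ι] [DecidableEq ι] [Fintype κ]
    (A : Matrix ι ι ℝ) (B : Matrix ι κ ℝ) : Prop :=
  ∃ K : Matrix κ ι ℝ, IsHurwitz (A + B * K)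

/-- `diag(M_k)`, for equally sized blocks, indexed by (block, position in the block). -/
def blkDiag {κ α β : Type*} [DecidableEq κ] (M : κ → Matrix α β ℝ) : Matrix (κ × α) (κ × β) ℝ :=
  (Matrix.blockDiagonal M).submatrix Prod.swap Prod.swap

/-- `v ⊗ I_Q` for a row vector `v`. -/
def rowKron {κ : Type*} (v : κ → ℝ) (Q : ℕ) : Matrix (Fin Q) (κ × Fin Q) ℝ :=
  (Matrix.replicateRow Unit v ⊗ₖ (1 : Matrix (Fin Q) (Fin Q) ℝ)).submatrix (fun r => ((), r)) id

/-! ### The communication graph -/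

/-- A weighted directed communication graph on the followers `Sum.inl i` and the leaders
`Sum.inr k`. There is an edge from `v` to `u` iff `0 < adj u v`; no self-connections; leaders
receive no information. -/
structure CommGraph (n m : ℕ) where
  adj : Matrix (Fin n ⊕ Fin m) (Fin n ⊕ Fin m) ℝ
  nonneg : ∀ u v, 0 ≤ adj u v
  hollow : ∀ u, adj u u = 0
  leader_row : ∀ (k : Fin m) v, adj (Sum.inr k) v = 0

namespace CommGraph

variable {n m : ℕ} (G : CommGraph n m)

/-- There is an edge from `u` to `v`. -/
def Edge (u v : Fin n ⊕ Fin m) : Prop := 0 < G.adj v u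

/-- There is a directed path from `u` to `v`. -/
def Reaches (u v : Fin n ⊕ Fin m) : Prop := Relation.TransGen G.Edge u v

/-- There is no directed cycle. -/
def Acyclic : Prop := ∀ v, ¬ G.Reaches v v

/-- The Laplacian. -/
def laplacian : Matrix (Fin n ⊕ Fin m) (Fin n ⊕ Fin m) ℝ :=
  Matrix.diagonal (fun u => ∑ v, G.adj u v) - G.adj

/-- The block `L₁` of the Laplacian. -/
def L1 : Matrix (Fin n) (Fin n) ℝ := G.laplacian.toBlocks₁₁

/-- The block `L₂` of the Laplacian. -/
def L2 : Matrix (Fin n) (Fin m) ℝ := G.laplacian.toBlocks₁₂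

/-- The normalized levels of influence `Φ_P = - L₁⁻¹ L₂` of the leaders on the followers. -/
def nli : Matrix (Fin n) (Fin m) ℝ := -(G.L1⁻¹ * G.L2)

open Classical in
/-- `N_i^L`: the leaders that are neighbors of follower `i`. -/
def nbrLeaders (i : Fin n) : Finset (Fin m) :=
  {k | G.adj (Sum.inl i) (Sum.inr k) ≠ 0}

open Classical in
/-- `N_i \ N_i^L`: the followers that are neighbors of follower `i`. -/
def nbrFollowers (i : Fin n) : Finset (Fin n) :=
  {j | G.adj (Sum.inl i) (Sum.inl j) ≠ 0}

/-- `N_i^A = ({i} ∪ N_i) \ N_i^L`. -/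
def nbrFollowersSelf (i : Fin n) : Finset (Fin n) := insert i (G.nbrFollowers i)

open Classical in
/-- `N_i^R`: the influential followers of follower `i`. -/
def influential (i : Fin n) : Finset (Fin n) :=
  {j | G.Reaches (Sum.inl j) (Sum.inl i)}

/-- The set of the influential followers of follower `i`, including itself. -/
def infFollowers (i : Fin n) : Finset (Fin n) :=
  (insert i (G.influential i)).biUnion G.nbrFollowersSelf

/-- The set of the influential leaders of follower `i`. -/
def infLeaders (i : Fin n) : Finset (Fin m) :=
  (insert i (G.influential i)).biUnion G.nbrLeaders

/-- The edges into follower `i` with their weights, as the graph of the function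
`(i, j) ↦ a_{ij}` on the pairs with `j` a neighbor of `i`. -/
def ownEdges (i : Fin n) : Set (((Fin n ⊕ Fin m) × (Fin n ⊕ Fin m)) × ℝ) :=
  {p | p.1.1 = Sum.inl i ∧ 0 < G.adj (Sum.inl i) p.1.2 ∧ p.2 = G.adj (Sum.inl i) p.1.2}

/-- The weighted edges of the local graph of follower `i`. -/
def infEdges (i : Fin n) : Set (((Fin n ⊕ Fin m) × (Fin n ⊕ Fin m)) × ℝ) :=
  ⋃ t ∈ insert i (G.influential i), G.ownEdges t

/-! ### Algorithm 1: distributed construction of the influential agents -/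

/-- The leader labels known to each follower after `k` exchanges. -/
def leadersIter : ℕ → Fin n → Finset (Fin m)
  | 0, i => G.nbrLeaders i
  | k + 1, i => (G.nbrFollowers i).biUnion (leadersIter k) ∪ G.nbrLeaders i

/-- The follower labels known to each follower after `k` exchanges. -/
def followersIter : ℕ → Fin n → Finset (Fin n)
  | 0, i => G.nbrFollowersSelf i
  | k + 1, i => (G.nbrFollowers i).biUnion (followersIter k) ∪ G.nbrFollowersSelf i

/-- The stopping test of follower `i` after `k` exchanges: nothing new for `i` in the last
exchange, nor for its neighbors in the exchange before. -/
def Stops1 (i : Fin n) (k : ℕ) : Prop :=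
  1 ≤ k ∧
  G.leadersIter k i \ G.leadersIter (k - 1) i = ∅ ∧
  G.followersIter k i \ G.followersIter (k - 1) i = ∅ ∧
  ∀ j ∈ G.nbrFollowers i, 2 ≤ k ∧
    G.leadersIter (k - 1) j \ G.leadersIter (k - 2) j = ∅ ∧
    G.followersIter (k - 1) j \ G.followersIter (k - 2) j = ∅

/-! ### Algorithm 2: distributed construction of the edges of the local graph -/

/-- The weighted edges known to each follower after `k` exchanges. -/
def edgesIter : ℕ → Fin n → Set (((Fin n ⊕ Fin m) × (Fin n ⊕ Fin m)) × ℝ)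
  | 0, i => G.ownEdges i
  | k + 1, i => (⋃ j ∈ G.nbrFollowers i, edgesIter k j) ∪ G.ownEdges i

/-- The stopping test of follower `i` after `k` exchanges. -/
def Stops2 (i : Fin n) (k : ℕ) : Prop :=
  1 ≤ k ∧
  G.edgesIter k i \ G.edgesIter (k - 1) i = ∅ ∧
  ∀ j ∈ G.nbrFollowers i, 2 ≤ k ∧ G.edgesIter (k - 1) j \ G.edgesIter (k - 2) j = ∅

/-! ### The followers that a leader influences -/

open Classical in
/-- The followers that are reachable from leader `k`. -/
def reachedBy (k : Fin m) : Finset (Fin n) := {i | k ∈ G.infLeaders i}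

/-- `H_k = L_k + δ_k`: the Laplacian of the subgraph of the followers reachable from leader `k`,
plus the diagonal matrix of the weights of the edges from leader `k`. -/
def H (k : Fin m) : Matrix (G.reachedBy k) (G.reachedBy k) ℝ :=
  (Matrix.diagonal (fun i : G.reachedBy k =>
      ∑ j : G.reachedBy k, G.adj (Sum.inl i.1) (Sum.inl j.1))
    - Matrix.of (fun i j : G.reachedBy k => G.adj (Sum.inl i.1) (Sum.inl j.1)))
  + Matrix.diagonal (fun i : G.reachedBy k => G.adj (Sum.inl i.1) (Sum.inr k))

/-- The permutation between coordinates grouped by followers and coordinates grouped by leaders. -/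
def regroup (q : ℕ) :
    (Σ i : Fin n, G.infLeaders i × Fin q) ≃ (Σ k : Fin m, G.reachedBy k × Fin q) where
  toFun p := ⟨p.2.1.1, ⟨p.1, by simp [reachedBy]⟩, p.2.2⟩
  invFun p := ⟨p.2.1.1, ⟨p.1, (Finset.mem_filter.1 p.2.1.2).2⟩, p.2.2⟩
  left_inv _ := rfl
  right_inv _ := rfl

/-! ### Exchange of estimates -/

/-- What follower `i` uses as the estimate by its neighbor `j` concerning leader `k`: the estimate
of `j` if `k` influences `j`, and otherwise its own. -/
def received {α : Type*} (z : ∀ i : Fin n, G.infLeaders i → α) (i j : Fin n)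
    (k : G.infLeaders i) : α :=
  if h : k.1 ∈ G.infLeaders j then z j ⟨k.1, h⟩ else z i k

/-- `∑_{j ∈ N_i \ N_i^L} a_{ij} (z_j^k - z_i^k) + a_{ik} (r_k - z_i^k)`. -/
def coupling {α : Type*} [AddCommGroup α] [Module ℝ α] (z : ∀ i : Fin n, G.infLeaders i → α)
    (r : Fin m → α) (i : Fin n) (k : G.infLeaders i) : α :=
  ∑ j ∈ G.nbrFollowers i, G.adj (Sum.inl i) (Sum.inl j) • (G.received z i j k - z i k)
    + G.adj (Sum.inl i) (Sum.inr k.1) • (r k.1 - z i k)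

end CommGraph

/-! ### Algorithm 3: local Laplacian and normalized levels of influence

The inputs are a set `NA` of followers, a set `NL` of leaders and a set `E` of weighted edges. -/

section Local

variable {n m : ℕ}

open Classical in
/-- The weight recorded in `E` for the pair `(u, v)`, and `0` if there is none. -/
def edgeWeight (E : Set (((Fin n ⊕ Fin m) × (Fin n ⊕ Fin m)) × ℝ)) (u v : Fin n ⊕ Fin m) : ℝ :=
  if h : ∃ w, ((u, v), w) ∈ E then h.choose else 0

/-- The local adjacency sub-matrix among followers. -/
def localAdj (NA : Finset (Fin n)) (E : Set (((Fin n ⊕ Fin m) × (Fin n ⊕ Fin m)) × ℝ)) :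
    Matrix NA NA ℝ :=
  Matrix.of fun a b => edgeWeight E (Sum.inl a.1) (Sum.inl b.1)

/-- The local adjacency sub-matrix from leaders to followers. -/
def localAdj2 (NA : Finset (Fin n)) (NL : Finset (Fin m))
    (E : Set (((Fin n ⊕ Fin m) × (Fin n ⊕ Fin m)) × ℝ)) : Matrix NA NL ℝ :=
  Matrix.of fun a c => edgeWeight E (Sum.inl a.1) (Sum.inr c.1)

/-- The local in-degree sub-matrix. -/
def localDeg (NA : Finset (Fin n)) (NL : Finset (Fin m))
    (E : Set (((Fin n ⊕ Fin m) × (Fin n ⊕ Fin m)) × ℝ)) : Matrix NA NA ℝ :=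
  Matrix.diagonal fun a => ∑ b, localAdj NA E a b + ∑ c, localAdj2 NA NL E a c

/-- The local Laplacian sub-matrix `L_{1ℓ}`. -/
def localL1 (NA : Finset (Fin n)) (NL : Finset (Fin m))
    (E : Set (((Fin n ⊕ Fin m) × (Fin n ⊕ Fin m)) × ℝ)) : Matrix NA NA ℝ :=
  localDeg NA NL E - localAdj NA E

/-- The local Laplacian sub-matrix `L_{2ℓ}`. -/
def localL2 (NA : Finset (Fin n)) (NL : Finset (Fin m))
    (E : Set (((Fin n ⊕ Fin m) × (Fin n ⊕ Fin m)) × ℝ)) : Matrix NA NL ℝ :=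
  -localAdj2 NA NL E

/-- The row vector `Υ_i` that selects follower `i`. -/
def selectRow (NA : Finset (Fin n)) (i : Fin n) : Matrix Unit NA ℝ :=
  Matrix.of fun _ a => if a.1 = i then 1 else 0

/-- The row vector `- Υ_i L_{1ℓ}⁻¹ L_{2ℓ}` returned to follower `i`. -/
def localNLI (NA : Finset (Fin n)) (NL : Finset (Fin m))
    (E : Set (((Fin n ⊕ Fin m) × (Fin n ⊕ Fin m)) × ℝ)) (i : Fin n) : Matrix Unit NL ℝ :=
  -(selectRow NA i * (localL1 NA NL E)⁻¹ * localL2 NA NL E)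

end Local

/-! ### The multi-agent system -/

/-- `n` heterogeneous followers `x_i' = A_i x_i + B_i u_i`, `y_i = C_i x_i` and `m` heterogeneous
leaders `ω_k' = S_k ω_k`, `y_k = D_k ω_k` on a communication graph. -/
structure MultiAgentSystem (n m q Q : ℕ) where
  G : CommGraph n m
  dimX : Fin n → ℕ
  dimU : Fin n → ℕ
  A : ∀ i, Matrix (Fin (dimX i)) (Fin (dimX i)) ℝ
  B : ∀ i, Matrix (Fin (dimX i)) (Fin (dimU i)) ℝ
  C : ∀ i, Matrix (Fin Q) (Fin (dimX i)) ℝ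
  S : Fin m → Matrix (Fin q) (Fin q) ℝ
  D : Fin m → Matrix (Fin Q) (Fin q) ℝ

namespace MultiAgentSystem

variable {n m q Q : ℕ} (M : MultiAgentSystem n m q Q)

/-- Coordinates of the stacked state `X = col(x_1, ..., x_n)`. -/
abbrev IdxX : Type := Σ i : Fin n, Fin (M.dimX i)

/-- Coordinates of the stacked leader estimates `η = col(η_1, ..., η_n)`, and of
`Ω = col(Ω_1^R, ..., Ω_n^R)`. -/
abbrev IdxEta : Type := Σ i : Fin n, M.G.infLeaders i × Fin q

/-- `diag(S_k)` over the influential leaders of follower `i`. -/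
def SR (i : Fin n) : Matrix (M.G.infLeaders i × Fin q) (M.G.infLeaders i × Fin q) ℝ :=
  blkDiag fun k => M.S k.1

/-- `diag(D_k)` over the influential leaders of follower `i`. -/
def DR (i : Fin n) : Matrix (M.G.infLeaders i × Fin Q) (M.G.infLeaders i × Fin q) ℝ :=
  blkDiag fun k => M.D k.1

/-- `Φ_{Pℓ}^i ⊗ I_Q`. -/
def nliKron (i : Fin n) : Matrix (Fin Q) (M.G.infLeaders i × Fin Q) ℝ :=
  rowKron (fun k : M.G.infLeaders i => M.G.nli i k.1) Q

/-- `(Pi, Ga)` solves the regulator equations of follower `i`. -/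
def SolvesRegulator (i : Fin n)
    (Pi : Matrix (Fin (M.dimX i)) (M.G.infLeaders i × Fin q) ℝ)
    (Ga : Matrix (Fin (M.dimU i)) (M.G.infLeaders i × Fin q) ℝ) : Prop :=
  Pi * M.SR i = M.A i * Pi + M.B i * Ga ∧ 0 = M.C i * Pi - M.nliKron i * M.DR i

/-! #### The closed-loop matrices (with converged estimates of the leaders' dynamics) -/

/-- `Θ = diag(Θ_k)`, `Θ_k = I ⊗ S_k - β (H_k ⊗ I_q)`, grouped by leaders. -/
def Theta (β : ℝ) : Matrix (Σ k : Fin m, M.G.reachedBy k × Fin q)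
    (Σ k : Fin m, M.G.reachedBy k × Fin q) ℝ :=
  Matrix.blockDiagonal' fun k =>
    (1 : Matrix (M.G.reachedBy k) (M.G.reachedBy k) ℝ) ⊗ₖ M.S k
      - β • (M.G.H k ⊗ₖ (1 : Matrix (Fin q) (Fin q) ℝ))

/-- `diag(β (H_k ⊗ I_q))`, grouped by leaders. -/
def ThetaBar (β : ℝ) : Matrix (Σ k : Fin m, M.G.reachedBy k × Fin q)
    (Σ k : Fin m, M.G.reachedBy k × Fin q) ℝ :=
  Matrix.blockDiagonal' fun k => β • (M.G.H k ⊗ₖ (1 : Matrix (Fin q) (Fin q) ℝ))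

/-- The closed-loop matrix `A_C`. -/
def AC (K1 : ∀ i, Matrix (Fin (M.dimU i)) (Fin (M.dimX i)) ℝ)
    (K2 : ∀ i, Matrix (Fin (M.dimU i)) (M.G.infLeaders i × Fin q) ℝ) (β : ℝ) :
    Matrix (M.IdxX ⊕ M.IdxEta) (M.IdxX ⊕ M.IdxEta) ℝ :=
  Matrix.fromBlocks
    (Matrix.blockDiagonal' M.A + Matrix.blockDiagonal' M.B * Matrix.blockDiagonal' K1)
    (Matrix.blockDiagonal' M.B * Matrix.blockDiagonal' K2)
    0
    ((M.Theta β).submatrix (M.G.regroup q) (M.G.regroup q))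

/-- The input matrix `B_C`. -/
def BC (β : ℝ) : Matrix (M.IdxX ⊕ M.IdxEta) M.IdxEta ℝ :=
  Matrix.fromRows 0 ((M.ThetaBar β).submatrix (M.G.regroup q) (M.G.regroup q))

/-- The output matrix `C_C`. -/
def CC : Matrix (Σ _ : Fin n, Fin Q) (M.IdxX ⊕ M.IdxEta) ℝ :=
  Matrix.fromCols (Matrix.blockDiagonal' M.C) 0

/-- The feedthrough matrix `D_C`. -/
def DC : Matrix (Σ _ : Fin n, Fin Q) M.IdxEta ℝ :=
  -(Matrix.blockDiagonal' M.nliKron * Matrix.blockDiagonal' M.DR)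

/-- `diag(diag(S_k))`, the dynamics of `Ω`. -/
def SRstack : Matrix M.IdxEta M.IdxEta ℝ := Matrix.blockDiagonal' M.SR

/-! #### Trajectories -/

/-- The stacked vector `Ω` of the states of the influential leaders of all the followers. -/
def Omega (ω : Fin m → Fin q → ℝ) : M.IdxEta → ℝ := fun p => ω p.2.1.1 p.2.2

/-- `X_C = col(X, η)`. -/
def stateC (x : ∀ i, Fin (M.dimX i) → ℝ) (η : ∀ i, M.G.infLeaders i → Fin q → ℝ) :
    M.IdxX ⊕ M.IdxEta → ℝ :=
  Sum.elim (fun p => x p.1 p.2) (fun p => η p.1 p.2.1 p.2.2)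

/-- The stacked containment error `E = C_C X_C + D_C Ω`. -/
def stackedError (X : M.IdxX ⊕ M.IdxEta → ℝ) (Ω : M.IdxEta → ℝ) : (Σ _ : Fin n, Fin Q) → ℝ :=
  M.CC *ᵥ X + M.DC *ᵥ Ω

/-- The reference trajectory `y_i^* = ([Φ_P]_i ⊗ I_Q) D^* col(ω_k)`, over all the leaders. -/
def reference (ω : Fin m → Fin q → ℝ) (i : Fin n) : Fin Q → ℝ :=
  (rowKron (M.G.nli i) Q * blkDiag M.D) *ᵥ (fun p : Fin m × Fin q => ω p.1 p.2)

/-- The control law `u_i = K_i^1 x_i + K_i^2 η_i`. -/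
def control (K1 : ∀ i, Matrix (Fin (M.dimU i)) (Fin (M.dimX i)) ℝ)
    (K2 : ∀ i, Matrix (Fin (M.dimU i)) (M.G.infLeaders i × Fin q) ℝ) (i : Fin n)
    (x : Fin (M.dimX i) → ℝ) (η : M.G.infLeaders i → Fin q → ℝ) : Fin (M.dimU i) → ℝ :=
  K1 i *ᵥ x + K2 i *ᵥ (fun p => η p.1 p.2)

/-- `(ω, x, η, Sh, Dh)` is a trajectory on `[0, ∞)` of the leaders, the followers under the
control law, and the adaptive distributed observer, where `η i k`, `Sh i k`, `Dh i k` are the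
estimates by follower `i` of the state and of the two matrices of its influential leader `k`. -/
structure IsTrajectory (K1 : ∀ i, Matrix (Fin (M.dimU i)) (Fin (M.dimX i)) ℝ)
    (K2 : ∀ i, Matrix (Fin (M.dimU i)) (M.G.infLeaders i × Fin q) ℝ) (βη βS βD : ℝ)
    (ω : ℝ → Fin m → Fin q → ℝ)
    (x : ℝ → ∀ i, Fin (M.dimX i) → ℝ)
    (η : ℝ → ∀ i, M.G.infLeaders i → Fin q → ℝ)
    (Sh : ℝ → ∀ i, M.G.infLeaders i → Matrix (Fin q) (Fin q) ℝ)
    (Dh : ℝ → ∀ i, M.G.infLeaders i → Matrix (Fin Q) (Fin q) ℝ) : Prop where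
  leader : ∀ t, 0 ≤ t → ∀ k,
    HasDerivWithinAt (fun s => ω s k) (M.S k *ᵥ ω t k) (Set.Ici 0) t
  follower : ∀ t, 0 ≤ t → ∀ i,
    HasDerivWithinAt (fun s => x s i)
      (M.A i *ᵥ x t i + M.B i *ᵥ M.control K1 K2 i (x t i) (η t i)) (Set.Ici 0) t
  observer_state : ∀ t, 0 ≤ t → ∀ i (k : M.G.infLeaders i),
    HasDerivWithinAt (fun s => η s i k)
      (Sh t i k *ᵥ η t i k + βη • M.G.coupling (η t) (ω t) i k) (Set.Ici 0) t
  observer_S : ∀ t, 0 ≤ t → ∀ i (k : M.G.infLeaders i) r c,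
    HasDerivWithinAt (fun s => Sh s i k r c)
      ((βS • M.G.coupling (Sh t) M.S i k) r c) (Set.Ici 0) t
  observer_D : ∀ t, 0 ≤ t → ∀ i (k : M.G.infLeaders i) r c,
    HasDerivWithinAt (fun s => Dh s i k r c)
      ((βD • M.G.coupling (Dh t) M.D i k) r c) (Set.Ici 0) t

end MultiAgentSystem

end

/-!
The three algorithms compute, by breadth-first search against the direction of the edges, the part
of the graph from which follower `i` can be reached. After `k` exchanges follower `i` knows the
ball `inBall i (k + 1)` of followers, and the leaders and edges adjacent to `inBall i k`; a ball that
does not grow in one step is closed under incoming edges, hence is the set of all influential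
followers (`CommGraph.Stops1.eq`, `CommGraph.Stops2.eq`). As no edge enters the local graph from
outside, the local Laplacian is the restriction of the global one, so the local levels of influence
are the global ones (`CommGraph.Acyclic.localNLI_eq`). Acyclicity gives an induction over followers
(`CommGraph.Acyclic.induction`) that replaces triangular forms of matrices: it shows that `L₁` is
invertible and that the levels of influence are nonnegative, add up to one and vanish for leaders
without influence.

An eigenvector of `A_C` is analysed by the same induction: at a first follower where its observer
part is nonzero it is an eigenvector of some `S_k - β d` with `β d > 0`, and without observer
part it is one of some `A_i + B_i K_i` (`MultiAgentSystem.isHurwitz_AC`).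

The regulator equations say that the graph `x_i = Π_i Ω_i`, `η = Ω` is invariant and that the error
vanishes on it. So the deviation `z` from this graph satisfies `z' = (A_C + P(t)) z + f(t)`, where
`P` and `f = P(t) col(Π_i Ω_i, Ω)` come from the errors of the estimates of the matrices `S_k`, and the
stacked error is `C_C z`. These estimates converge at an exponential rate `ε` (induction over
followers again), while `e^{-εt} ω_k → 0` because `S_k - ε` is Hurwitz; hence `P → 0` and `f → 0`
(`MultiAgentSystem.IsTrajectory.exists_rate`). Finally `z → 0` by a quadratic Lyapunov function
(`IsHurwitz.tendsto_zero`), which is built from the factors of the characteristic polynomial, one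
root at a time (`exists_lyapunov_of_list`). The containment claim follows since the reference output
is a convex combination of the leaders' outputs.
-/

noncomputable section

/-! ### Acyclic graphs and the followers that influence a follower -/

namespace CommGraph

variable {n m : ℕ} {G : CommGraph n m}

/-- Induction along the edges between followers of an acyclic graph. -/
theorem Acyclic.induction (h : G.Acyclic) {P : Fin n → Prop}
    (ih : ∀ i, (∀ j ∈ G.nbrFollowers i, P j) → P i) (i : Fin n) : P i := by
  let r : Fin n → Fin n → Prop := fun j i => G.Reaches (Sum.inl j) (Sum.inl i)
  have : IsTrans (Fin n) r := ⟨fun _ _ _ => Relation.TransGen.trans⟩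
  have : Std.Irrefl r := ⟨fun i => h _⟩
  have wf : WellFounded r := Finite.wellFounded_of_trans_of_irrefl r
  induction i using wf.induction with
  | _ i hi =>
    refine ih i fun j hj => hi j (Relation.TransGen.single ?_)
    simp only [nbrFollowers, Finset.mem_filter, Finset.mem_univ, true_and] at hj
    exact lt_of_le_of_ne (G.nonneg _ _) (Ne.symm hj)

theorem mem_nbrFollowers {i j : Fin n} :
    j ∈ G.nbrFollowers i ↔ 0 < G.adj (Sum.inl i) (Sum.inl j) := by
  simp [nbrFollowers, (G.nonneg (Sum.inl i) (Sum.inl j)).lt_iff_ne']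

theorem mem_nbrLeaders {i : Fin n} {k : Fin m} :
    k ∈ G.nbrLeaders i ↔ 0 < G.adj (Sum.inl i) (Sum.inr k) := by
  simp [nbrLeaders, (G.nonneg (Sum.inl i) (Sum.inr k)).lt_iff_ne']

theorem adj_eq_zero_of_notMem_nbrFollowers {i j : Fin n} (h : j ∉ G.nbrFollowers i) :
    G.adj (Sum.inl i) (Sum.inl j) = 0 :=
  le_antisymm (not_lt.1 fun h' => h (mem_nbrFollowers.2 h')) (G.nonneg _ _)

theorem adj_eq_zero_of_notMem_nbrLeaders {i : Fin n} {k : Fin m} (h : k ∉ G.nbrLeaders i) :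
    G.adj (Sum.inl i) (Sum.inr k) = 0 :=
  le_antisymm (not_lt.1 fun h' => h (mem_nbrLeaders.2 h')) (G.nonneg _ _)

theorem not_edge_leader (u : Fin n ⊕ Fin m) (k : Fin m) : ¬ G.Edge u (Sum.inr k) := by
  simp [Edge, G.leader_row]

variable (G)

/-- The followers with a directed path of length at most `k` to follower `i`. -/
def inBall (i : Fin n) : ℕ → Finset (Fin n)
  | 0 => {i}
  | k + 1 => (inBall i k).biUnion G.nbrFollowersSelf

variable {G}

theorem inBall_subset_succ (i : Fin n) (k : ℕ) : G.inBall i k ⊆ G.inBall i (k + 1) := fun j hj =>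
  Finset.mem_biUnion.2 ⟨j, hj, Finset.mem_insert_self _ _⟩

theorem inBall_mono (i : Fin n) : Monotone (G.inBall i) :=
  monotone_nat_of_le_succ (inBall_subset_succ i)

theorem mem_inBall_self (i : Fin n) (k : ℕ) : i ∈ G.inBall i k :=
  inBall_mono i (Nat.zero_le k) (by simp [inBall])

/-- A path to `i` of positive length enters `i` from one of its neighbors. -/
theorem inBall_succ (i : Fin n) (k : ℕ) :
    G.inBall i (k + 1) = insert i ((G.nbrFollowers i).biUnion fun j => G.inBall j k) := by
  induction k with
  | zero => ext; simp [inBall, nbrFollowersSelf]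
  | succ k ih =>
    have h1 : G.inBall i (k + 2) = (G.inBall i (k + 1)).biUnion G.nbrFollowersSelf := rfl
    rw [h1, ih, Finset.biUnion_insert, Finset.biUnion_biUnion]
    ext t
    have h2 : t ∈ G.nbrFollowers i → ∃ j ∈ G.nbrFollowers i, t ∈ G.inBall j (k + 1) :=
      fun ht => ⟨t, ht, mem_inBall_self _ _⟩
    simp only [inBall, Finset.mem_union, Finset.mem_biUnion, Finset.mem_insert,
      nbrFollowersSelf] at h2 ⊢
    exact ⟨fun h => h.elim (fun h => h.elim Or.inl fun h => Or.inr (h2 h)) Or.inr,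
      fun h => h.elim (fun h => .inl (.inl h)) .inr⟩

theorem inBall_stable {i : Fin n} {k : ℕ} (h : G.inBall i (k + 1) = G.inBall i k) {l : ℕ}
    (hl : k ≤ l) : G.inBall i l = G.inBall i k := by
  induction l, hl using Nat.le_induction with
  | base => rfl
  | succ l _ ih => rw [inBall, ih]; exact h

theorem followersIter_eq (k : ℕ) (i : Fin n) : G.followersIter k i = G.inBall i (k + 1) := by
  induction k generalizing i with
  | zero => simp [followersIter, inBall]
  | succ k ih =>
    rw [inBall_succ, followersIter, funext ih]
    ext t
    have h2 : t ∈ G.nbrFollowers i → ∃ j ∈ G.nbrFollowers i, t ∈ G.inBall j (k + 1) :=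
      fun ht => ⟨t, ht, mem_inBall_self _ _⟩
    simp only [Finset.mem_union, Finset.mem_biUnion, Finset.mem_insert, nbrFollowersSelf]
    exact ⟨fun h => h.elim Or.inr fun h => h.elim Or.inl fun h => Or.inr (h2 h),
      fun h => h.elim (fun h => .inr (.inl h)) .inl⟩

theorem leadersIter_eq (k : ℕ) (i : Fin n) :
    G.leadersIter k i = (G.inBall i k).biUnion G.nbrLeaders := by
  induction k generalizing i with
  | zero => simp [leadersIter, inBall]
  | succ k ih =>
    rw [inBall_succ, leadersIter, Finset.biUnion_insert, Finset.biUnion_biUnion,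
      Finset.union_comm, funext ih]

theorem edgesIter_eq (k : ℕ) (i : Fin n) :
    G.edgesIter k i = ⋃ t ∈ G.inBall i k, G.ownEdges t := by
  induction k generalizing i with
  | zero => simp [edgesIter, inBall]
  | succ k ih =>
    rw [inBall_succ, edgesIter, Finset.set_biUnion_insert, Finset.set_biUnion_biUnion,
      Set.union_comm]
    simp only [ih]

/-- Follower `i` together with the followers that have a directed path to it. -/
theorem mem_insert_influential {i j : Fin n} :
    j ∈ insert i (G.influential i) ↔ j = i ∨ G.Reaches (Sum.inl j) (Sum.inl i) := by
  simp [influential]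

theorem mem_influential_of_mem_nbrFollowers {i j t : Fin n}
    (hj : j ∈ insert i (G.influential i)) (ht : t ∈ G.nbrFollowers j) :
    t ∈ insert i (G.influential i) := by
  have e : G.Edge (Sum.inl t) (Sum.inl j) := mem_nbrFollowers.1 ht
  rw [mem_insert_influential] at hj ⊢
  rcases hj with rfl | hj
  · exact Or.inr (.single e)
  · exact Or.inr (.head e hj)

theorem inBall_subset (i : Fin n) (k : ℕ) : G.inBall i k ⊆ insert i (G.influential i) := by
  induction k with
  | zero => simp [inBall]
  | succ k ih =>
    intro t ht
    obtain ⟨j, hj, ht⟩ := Finset.mem_biUnion.1 ht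
    rcases Finset.mem_insert.1 ht with rfl | ht
    · exact ih hj
    · exact mem_influential_of_mem_nbrFollowers (ih hj) ht

/-- Every influential follower is at a finite distance; paths to a follower visit no leader
after their first node, because leaders have no incoming edges. -/
theorem exists_mem_inBall {i j : Fin n} (h : j ∈ insert i (G.influential i)) :
    ∃ k, j ∈ G.inBall i k := by
  have key : ∀ u, G.Reaches u (Sum.inl i) → ∀ j, u = Sum.inl j → ∃ k, j ∈ G.inBall i k := by
    intro u hu
    induction hu using Relation.TransGen.head_induction_on with
    | single e =>
      rintro j rfl
      exact ⟨1, by simpa [inBall, nbrFollowersSelf, mem_nbrFollowers, Edge] using Or.inr e⟩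
    | @head a c e _ ih =>
      rintro j rfl
      rcases c with c | c
      · obtain ⟨k, hk⟩ := ih c rfl
        exact ⟨k + 1, Finset.mem_biUnion.2 ⟨c, hk, by
          simpa [nbrFollowersSelf, mem_nbrFollowers, Edge] using Or.inr e⟩⟩
      · exact absurd e (not_edge_leader _ _)
  rcases mem_insert_influential.1 h with rfl | h
  · exact ⟨0, mem_inBall_self _ _⟩
  · exact key _ h j rfl

theorem eventually_inBall_eq (i : Fin n) :
    ∀ᶠ k in atTop, G.inBall i k = insert i (G.influential i) := by
  have : ∀ᶠ k in atTop, ∀ j ∈ insert i (G.influential i), j ∈ G.inBall i k := by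
    rw [eventually_all_finset]
    intro j hj
    obtain ⟨k, hk⟩ := exists_mem_inBall hj
    exact eventually_atTop.2 ⟨k, fun l hl => inBall_mono i hl hk⟩
  filter_upwards [this] with k hk
  exact (inBall_subset i k).antisymm hk

theorem inBall_eq_of_stable {i : Fin n} {k : ℕ} (h : G.inBall i (k + 1) = G.inBall i k) :
    G.inBall i k = insert i (G.influential i) := by
  obtain ⟨l, hl, hkl⟩ := ((eventually_inBall_eq (G := G) i).and (eventually_ge_atTop k)).exists
  rw [← hl, inBall_stable h hkl]

theorem infFollowers_eq (i : Fin n) : G.infFollowers i = insert i (G.influential i) := by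
  ext t
  constructor
  · intro ht
    obtain ⟨j, hj, ht⟩ := Finset.mem_biUnion.1 ht
    rcases Finset.mem_insert.1 ht with rfl | ht
    · exact hj
    · exact mem_influential_of_mem_nbrFollowers hj ht
  · exact fun ht => Finset.mem_biUnion.2 ⟨t, ht, Finset.mem_insert_self _ _⟩

/-- The leaders that influence a follower are its own leader neighbors and those that influence
its follower neighbors. -/
theorem mem_infLeaders_iff {i : Fin n} {k : Fin m} :
    k ∈ G.infLeaders i ↔ k ∈ G.nbrLeaders i ∨ ∃ j ∈ G.nbrFollowers i, k ∈ G.infLeaders j := by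
  have h : ∀ᶠ l in atTop, ∀ j : Fin n, G.inBall j l = insert j (G.influential j) :=
    eventually_all.2 fun j => eventually_inBall_eq j
  obtain ⟨l, hl, hl'⟩ := (h.and ((tendsto_add_atTop_nat 1).eventually h)).exists
  simp only [infLeaders, ← hl]
  rw [hl i, ← hl' i, inBall_succ, Finset.biUnion_insert, Finset.biUnion_biUnion]
  simp only [Finset.mem_union, Finset.mem_biUnion]

/-! ### Termination and correctness of the set-valued algorithms -/

/-- All the sets have reached their limits after finitely many exchanges. -/
theorem eventually_iter_eq : ∀ᶠ k in atTop, ∀ i : Fin n,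
    G.followersIter k i = G.infFollowers i ∧ G.leadersIter k i = G.infLeaders i ∧
      G.edgesIter k i = G.infEdges i := by
  have h : ∀ᶠ l in atTop, ∀ j : Fin n, G.inBall j l = insert j (G.influential j) :=
    eventually_all.2 fun j => eventually_inBall_eq j
  filter_upwards [h, (tendsto_add_atTop_nat 1).eventually h] with k hk hk' i
  rw [followersIter_eq, leadersIter_eq, edgesIter_eq, hk, hk', infFollowers_eq]
  exact ⟨rfl, rfl, rfl⟩

variable (G) in
theorem exists_stops (i : Fin n) : (∃ k, G.Stops1 i k) ∧ ∃ k, G.Stops2 i k := by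
  obtain ⟨N, hN⟩ := eventually_atTop.1 (eventually_iter_eq (G := G))
  have e0 := hN (N + 2) (by lia)
  have e1 := hN (N + 1) (by lia)
  have e2 := hN N le_rfl
  refine ⟨⟨N + 2, by lia, ?_, ?_, fun j _ => ⟨by lia, ?_, ?_⟩⟩,
    ⟨N + 2, by lia, ?_, fun j _ => ⟨by lia, ?_⟩⟩⟩ <;>
  simp [e0, e1, e2]

/-- If the known followers do not grow in one exchange, they never grow again; the leaders known
after `k` exchanges are the neighbors of the followers known after `k - 1`. -/
theorem Stops1.eq {i : Fin n} {k : ℕ} (h : G.Stops1 i k) :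
    G.followersIter k i = G.infFollowers i ∧ G.leadersIter k i = G.infLeaders i := by
  obtain ⟨hk, -, h2, -⟩ := h
  obtain ⟨k, rfl⟩ : ∃ l, k = l + 1 := ⟨k - 1, by lia⟩
  rw [Nat.add_sub_cancel, Finset.sdiff_eq_empty_iff_subset, followersIter_eq,
    followersIter_eq] at h2
  have h3 := h2.antisymm (inBall_subset_succ i (k + 1))
  have h4 := inBall_eq_of_stable h3
  rw [followersIter_eq, leadersIter_eq, h3, h4, infFollowers_eq]
  exact ⟨rfl, rfl⟩

/-- As each follower has an incoming edge, a newly found follower would bring a new edge in the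
next exchange; so if the known edges do not grow, then neither did the known followers. -/
theorem Stops2.eq {i : Fin n} {k : ℕ} (hin : ∀ i : Fin n, ∃ u, G.Edge u (Sum.inl i))
    (h : G.Stops2 i k) : G.edgesIter k i = G.infEdges i := by
  obtain ⟨hk, h2, -⟩ := h
  obtain ⟨k, rfl⟩ : ∃ l, k = l + 1 := ⟨k - 1, by lia⟩
  rw [Nat.add_sub_cancel, Set.sdiff_eq_empty, edgesIter_eq, edgesIter_eq] at h2
  have h3 : G.inBall i (k + 1) = G.inBall i k := by
    refine Finset.Subset.antisymm (fun t ht => ?_) (inBall_subset_succ i k)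
    obtain ⟨u, hu⟩ := hin t
    have h4 : ((Sum.inl t, u), G.adj (Sum.inl t) u) ∈ ⋃ t ∈ G.inBall i k, G.ownEdges t :=
      h2 (Set.mem_biUnion (x := t) ht ⟨rfl, hu, rfl⟩)
    simp only [Set.mem_iUnion] at h4
    obtain ⟨s, hs, h5, -⟩ := h4
    rw [Sum.inl.inj h5]
    exact hs
  rw [edgesIter_eq, h3, inBall_eq_of_stable h3]
  rfl

/-! ### The normalized levels of influence -/

/-- The in-degree of follower `i`. -/
def inDegree (G : CommGraph n m) (i : Fin n) : ℝ :=
  ∑ j, G.adj (Sum.inl i) (Sum.inl j) + ∑ k, G.adj (Sum.inl i) (Sum.inr k)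

theorem inDegree_pos {i : Fin n} (h : ∃ u, G.Edge u (Sum.inl i)) : 0 < G.inDegree i := by
  obtain ⟨u, hu⟩ := h
  have h1 : ∑ u, G.adj (Sum.inl i) u = G.inDegree i := Fintype.sum_sum_type _
  rw [← h1]
  exact Finset.sum_pos' (fun _ _ => G.nonneg _ _) ⟨u, Finset.mem_univ _, hu⟩

theorem L1_mulVec (v : Fin n → ℝ) (i : Fin n) :
    (G.L1 *ᵥ v) i = G.inDegree i * v i - ∑ j, G.adj (Sum.inl i) (Sum.inl j) * v j := by
  have h : G.L1 = Matrix.diagonal G.inDegree - G.adj.toBlocks₁₁ := by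
    ext a b
    simp [L1, laplacian, toBlocks₁₁, Matrix.diagonal_apply, inDegree]
  rw [h, Matrix.sub_mulVec, Pi.sub_apply, Matrix.mulVec_diagonal]
  rfl

/-- A vector in the kernel of `L₁` is at each follower a multiple of a combination of its values at
the follower neighbors, so it vanishes by induction along the edges. -/
theorem Acyclic.isUnit_L1 (h : G.Acyclic) (hin : ∀ i : Fin n, ∃ u, G.Edge u (Sum.inl i)) :
    IsUnit G.L1 := by
  rw [← Matrix.mulVec_injective_iff_isUnit, ← Matrix.coe_mulVecLin, injective_iff_map_eq_zero]
  intro v hv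
  funext i
  induction i using h.induction with
  | ih i ih =>
    have h1 := congrFun hv i
    rw [Matrix.mulVecLin_apply, L1_mulVec, Finset.sum_eq_zero, sub_zero] at h1
    · exact (mul_eq_zero.1 h1).resolve_left (inDegree_pos (hin i)).ne'
    · intro j _
      by_cases hj : j ∈ G.nbrFollowers i
      · rw [ih j hj, Pi.zero_apply, mul_zero]
      · rw [adj_eq_zero_of_notMem_nbrFollowers hj, zero_mul]

/-- The levels of influence at a follower are the weighted averages of those at its neighbors. -/
theorem Acyclic.inDegree_mul_nli (h : G.Acyclic) (hin : ∀ i : Fin n, ∃ u, G.Edge u (Sum.inl i))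
    (i : Fin n) (k : Fin m) :
    G.inDegree i * G.nli i k =
      ∑ j, G.adj (Sum.inl i) (Sum.inl j) * G.nli j k + G.adj (Sum.inl i) (Sum.inr k) := by
  have h1 : G.L1 * G.nli = -G.L2 := by
    rw [nli, Matrix.mul_neg, Matrix.mul_nonsing_inv_cancel_left]
    exact (Matrix.isUnit_iff_isUnit_det _).1 (h.isUnit_L1 hin)
  have h2 : (G.L1 *ᵥ fun j => G.nli j k) i = (-G.L2) i k := by rw [← h1]; rfl
  rw [L1_mulVec] at h2
  have h3 : (-G.L2) i k = G.adj (Sum.inl i) (Sum.inr k) := by simp [L2, laplacian, toBlocks₁₂]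
  linarith

theorem Acyclic.nli_nonneg (h : G.Acyclic) (hin : ∀ i : Fin n, ∃ u, G.Edge u (Sum.inl i))
    (i : Fin n) (k : Fin m) : 0 ≤ G.nli i k := by
  induction i using h.induction with
  | ih i ih =>
    have h1 := h.inDegree_mul_nli hin i k
    refine nonneg_of_mul_nonneg_right (h1 ▸ add_nonneg (Finset.sum_nonneg fun j _ => ?_)
      (G.nonneg _ _)) (inDegree_pos (hin i))
    by_cases hj : j ∈ G.nbrFollowers i
    · exact mul_nonneg (G.nonneg _ _) (ih j hj)
    · rw [adj_eq_zero_of_notMem_nbrFollowers hj, zero_mul]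

theorem Acyclic.nli_sum (h : G.Acyclic) (hin : ∀ i : Fin n, ∃ u, G.Edge u (Sum.inl i))
    (i : Fin n) : ∑ k, G.nli i k = 1 := by
  induction i using h.induction with
  | ih i ih =>
    have h1 : G.inDegree i * ∑ k, G.nli i k = G.inDegree i * 1 := by
      rw [Finset.mul_sum, mul_one, Finset.sum_congr rfl fun k _ => h.inDegree_mul_nli hin i k,
        Finset.sum_add_distrib, Finset.sum_comm, inDegree]
      congr 1
      refine Finset.sum_congr rfl fun j _ => ?_
      rw [← Finset.mul_sum]
      by_cases hj : j ∈ G.nbrFollowers i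
      · rw [ih j hj, mul_one]
      · rw [adj_eq_zero_of_notMem_nbrFollowers hj, zero_mul]
    exact mul_left_cancel₀ (inDegree_pos (hin i)).ne' h1

theorem Acyclic.nli_eq_zero (h : G.Acyclic) (hin : ∀ i : Fin n, ∃ u, G.Edge u (Sum.inl i))
    {i : Fin n} {k : Fin m} (hk : k ∉ G.infLeaders i) : G.nli i k = 0 := by
  induction i using h.induction with
  | ih i ih =>
    rw [mem_infLeaders_iff, not_or] at hk
    have h1 := h.inDegree_mul_nli hin i k
    rw [adj_eq_zero_of_notMem_nbrLeaders hk.1, Finset.sum_eq_zero, add_zero] at h1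
    · exact (mul_eq_zero.1 h1).resolve_left (inDegree_pos (hin i)).ne'
    · intro j _
      by_cases hj : j ∈ G.nbrFollowers i
      · rw [ih j hj fun hkj => hk.2 ⟨j, hj, hkj⟩, mul_zero]
      · rw [adj_eq_zero_of_notMem_nbrFollowers hj, zero_mul]

/-! ### The local computation of the levels of influence -/

theorem edgeWeight_infEdges {i t : Fin n} (ht : t ∈ insert i (G.influential i))
    (u : Fin n ⊕ Fin m) : edgeWeight (G.infEdges i) (Sum.inl t) u = G.adj (Sum.inl t) u := by
  have hmem : ∀ w, ((Sum.inl t, u), w) ∈ G.infEdges i ↔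
      0 < G.adj (Sum.inl t) u ∧ w = G.adj (Sum.inl t) u := by
    intro w
    simp only [infEdges, ownEdges, Set.mem_iUnion, Set.mem_ofPred_eq, exists_prop]
    constructor
    · rintro ⟨s, -, hs, h1, h2⟩
      obtain rfl := Sum.inl.inj hs
      exact ⟨h1, h2⟩
    · exact fun h => ⟨t, ht, rfl, h⟩
  unfold edgeWeight
  split_ifs with h
  · exact ((hmem _).1 h.choose_spec).2
  · refine le_antisymm (G.nonneg _ _) (not_lt.1 fun h' => h ⟨_, (hmem _).2 ⟨h', rfl⟩⟩)

/-- The local Laplacian acts as the global one because no edge enters the local graph from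
outside. -/
theorem localL1_mulVec (i : Fin n) (v : Fin n → ℝ) (a : G.infFollowers i) :
    (localL1 (G.infFollowers i) (G.infLeaders i) (G.infEdges i) *ᵥ fun b => v b.1) a =
      (G.L1 *ᵥ v) a.1 := by
  have ha : a.1 ∈ insert i (G.influential i) := infFollowers_eq (G := G) i ▸ a.2
  have hF : ∀ w : Fin n → ℝ, ∑ b : G.infFollowers i, G.adj (Sum.inl a.1) (Sum.inl b.1) * w b.1 =
      ∑ j, G.adj (Sum.inl a.1) (Sum.inl j) * w j := by
    intro w
    rw [Finset.sum_coe_sort (G.infFollowers i) fun j => G.adj (Sum.inl a.1) (Sum.inl j) * w j]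
    refine Finset.sum_subset (Finset.subset_univ _) fun j _ hj => ?_
    rw [adj_eq_zero_of_notMem_nbrFollowers fun h => hj ?_, zero_mul]
    rw [infFollowers_eq]
    exact mem_influential_of_mem_nbrFollowers ha h
  have hL : ∑ c : G.infLeaders i, G.adj (Sum.inl a.1) (Sum.inr c.1) =
      ∑ k, G.adj (Sum.inl a.1) (Sum.inr k) := by
    rw [Finset.sum_coe_sort (G.infLeaders i) fun k => G.adj (Sum.inl a.1) (Sum.inr k)]
    refine Finset.sum_subset (Finset.subset_univ _) fun k _ hk => ?_
    exact adj_eq_zero_of_notMem_nbrLeaders fun h => hk (Finset.mem_biUnion.2 ⟨a.1, ha, h⟩)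
  have hF1 := hF 1
  simp only [Pi.one_apply, mul_one] at hF1
  rw [L1_mulVec, localL1, Matrix.sub_mulVec, Pi.sub_apply, localDeg, Matrix.mulVec_diagonal]
  simp only [Matrix.mulVec, dotProduct, localAdj, localAdj2, of_apply, edgeWeight_infEdges ha]
  rw [hF, hL, hF1, inDegree]

theorem Acyclic.isUnit_localL1 (h : G.Acyclic) (hin : ∀ i : Fin n, ∃ u, G.Edge u (Sum.inl i))
    (i : Fin n) :
    IsUnit (localL1 (G.infFollowers i) (G.infLeaders i) (G.infEdges i)) := by
  rw [← Matrix.mulVec_injective_iff_isUnit, ← Matrix.coe_mulVecLin, injective_iff_map_eq_zero]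
  intro v hv
  let w : Fin n → ℝ := fun j => if hj : j ∈ G.infFollowers i then v ⟨j, hj⟩ else 0
  have hw : (fun b : G.infFollowers i => w b.1) = v := by funext b; simp [w]
  have hall : ∀ j (hj : j ∈ G.infFollowers i), v ⟨j, hj⟩ = 0 := by
    intro j
    induction j using h.induction with
    | ih j ih =>
      intro hj
      have h1 := congrFun hv ⟨j, hj⟩
      rw [Matrix.mulVecLin_apply, ← hw, localL1_mulVec, L1_mulVec, Finset.sum_eq_zero,
        sub_zero] at h1
      · have h2 := (mul_eq_zero.1 h1).resolve_left (inDegree_pos (hin j)).ne'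
        simpa [w, hj] using h2
      · intro t _
        by_cases ht : t ∈ G.nbrFollowers j
        · by_cases ht' : t ∈ G.infFollowers i
          · simp [w, ht', ih t ht ht']
          · simp [w, ht']
        · rw [adj_eq_zero_of_notMem_nbrFollowers ht, zero_mul]
  funext a
  exact hall a.1 a.2

theorem Acyclic.localNLI_eq (h : G.Acyclic) (hin : ∀ i : Fin n, ∃ u, G.Edge u (Sum.inl i))
    (i : Fin n) (l : G.infLeaders i) :
    localNLI (G.infFollowers i) (G.infLeaders i) (G.infEdges i) i () l = G.nli i l.1 := by
  have hi : i ∈ G.infFollowers i := by rw [infFollowers_eq]; exact Finset.mem_insert_self _ _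
  set L := localL1 (G.infFollowers i) (G.infLeaders i) (G.infEdges i) with hL
  have h1 : (L * Matrix.of fun (b : G.infFollowers i) (c : G.infLeaders i) => G.nli b.1 c.1) =
      -localL2 (G.infFollowers i) (G.infLeaders i) (G.infEdges i) := by
    ext a c
    have ha : a.1 ∈ insert i (G.influential i) := infFollowers_eq (G := G) i ▸ a.2
    have h2 := localL1_mulVec i (fun j => G.nli j c.1) a
    rw [L1_mulVec, h.inDegree_mul_nli hin] at h2
    simp only [localL2, localAdj2, neg_neg, of_apply, edgeWeight_infEdges ha]
    rw [add_sub_cancel_left] at h2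
    exact h2
  have hu : IsUnit L.det := (Matrix.isUnit_iff_isUnit_det _).1 (h.isUnit_localL1 hin i)
  rw [localNLI, ← hL, Matrix.mul_assoc, ← Matrix.mul_neg, ← Matrix.mul_neg, ← h1,
    Matrix.nonsing_inv_mul_cancel_left _ _ hu]
  rw [Matrix.mul_apply, Finset.sum_eq_single ⟨i, hi⟩]
  · simp [selectRow]
  · intro b _ hb
    have : b.1 ≠ i := fun h => hb (Subtype.ext h)
    simp [selectRow, this]
  · simp

theorem exists_edge_of_reaches {u v : Fin n ⊕ Fin m} (h : G.Reaches u v) : ∃ w, G.Edge w v := by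
  obtain ⟨w, -, hw⟩ := Relation.TransGen.tail'_iff.1 h
  exact ⟨w, hw⟩

end CommGraph

/-! ### Quadratic Lyapunov functions of Hurwitz matrices -/

/-- `V` is a quadratic Lyapunov function for `x' = A x` on the subspace annihilated by the product
of the `A - l` over the list `s`. With `w = (A - l) x`, the function `‖x‖² + c V(w)` serves
for `l :: s` when `V` serves for `s` and `c` is large, since `A x = l x + w`. -/
theorem exists_lyapunov_of_list {E : Type*} [NormedAddCommGroup E] [InnerProductSpace ℂ E]
    (A : E →L[ℂ] E) (s : List ℂ) (hs : ∀ l ∈ s, l.re < 0) :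
    ∃ (V : E →L[ℝ] E →L[ℝ] ℝ) (a : ℝ), 0 < a ∧
      ∀ x, (s.map fun l => A - l • (1 : E →L[ℂ] E)).prod x = 0 →
        ‖x‖ ^ 2 ≤ V x x ∧ V x (A x) + V (A x) x ≤ -a * V x x := by
  let _ : InnerProductSpace ℝ E := InnerProductSpace.rclikeToReal ℂ E
  induction s with
  | nil =>
    refine ⟨0, 1, one_pos, fun x hx => ?_⟩
    have : x = 0 := by simpa using hx
    simp [this]
  | cons l s ih =>
    obtain ⟨V, a, ha, hV⟩ := ih fun k hk => hs k (List.mem_cons_of_mem _ hk)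
    have hl : 0 < -l.re := neg_pos.2 (hs l List.mem_cons_self)
    set μ := -l.re with hμ
    let N : E →L[ℝ] E := (A - l • (1 : E →L[ℂ] E)).restrictScalars ℝ
    let c : ℝ := 2 / (μ * a)
    have hc : 0 < c := by positivity
    refine ⟨(innerₗ E).mkContinuous₂ 1
        (fun x y => by simpa using norm_inner_le_norm (𝕜 := ℝ) x y) + c • V.bilinearComp N N,
      min μ (a / 2), by positivity, fun x hx => ?_⟩
    have hcomm : ∀ k : ℂ, Commute (A - l • (1 : E →L[ℂ] E)) (A - k • (1 : E →L[ℂ] E)) := fun k =>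
      (((Commute.refl A).sub_right ((Commute.one_right A).smul_right k))).sub_left
        (((Commute.one_left _).smul_left l))
    have hcp : Commute (A - l • (1 : E →L[ℂ] E))
        (s.map fun l => A - l • (1 : E →L[ℂ] E)).prod := by
      refine Commute.list_prod_right _ _ fun y hy => ?_
      obtain ⟨k, -, rfl⟩ := List.mem_map.1 hy
      exact hcomm k
    have hw : (s.map fun l => A - l • (1 : E →L[ℂ] E)).prod (N x) = 0 := by
      rw [List.map_cons, List.prod_cons, hcp.eq] at hx
      exact hx
    obtain ⟨h1, h2⟩ := hV _ hw
    have hNA : N (A x) = A (N x) := by simp [N]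
    have hAx : A x = l • x + N x := by simp [N]
    have hnorm : inner ℝ x (A x) + inner ℝ (A x) x ≤ -2 * μ * ‖x‖ ^ 2 + 2 * (‖x‖ * ‖N x‖) := by
      have e1 : inner ℝ x (l • x) = l.re * ‖x‖ ^ 2 := by
        rw [real_inner_eq_re_inner ℂ, inner_smul_right, inner_self_eq_norm_sq_to_K]
        simp [← Complex.ofReal_pow]
      have e2 := real_inner_le_norm x (N x)
      rw [real_inner_comm x (A x), hAx, inner_add_right, e1]
      linarith
    simp only [_root_.add_apply, _root_.smul_apply, smul_eq_mul,
      ContinuousLinearMap.bilinearComp_apply, LinearMap.mkContinuous₂_apply, innerₗ_apply_apply, hNA]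
    set W := V (N x) (N x)
    have hW : 0 ≤ W := (sq_nonneg _).trans h1
    have hxx : inner ℝ x x = ‖x‖ ^ 2 := real_inner_self_eq_norm_sq x
    rw [hxx]
    refine ⟨by nlinarith [mul_nonneg hc.le hW], ?_⟩
    -- Young's inequality, and the choice of `c`
    have hy : 2 * (‖x‖ * ‖N x‖) ≤ μ * ‖x‖ ^ 2 + W / μ := by
      have : ‖N x‖ ^ 2 / μ ≤ W / μ := by gcongr
      have h3 : 0 ≤ (μ * ‖x‖ - ‖N x‖) ^ 2 / μ := by positivity
      have h4 : (μ * ‖x‖ - ‖N x‖) ^ 2 / μ =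
          μ * ‖x‖ ^ 2 + ‖N x‖ ^ 2 / μ - 2 * (‖x‖ * ‖N x‖) := by
        field_simp
        ring
      linarith
    have hca : c * a * W = 2 * (W / μ) := by
      simp only [c]
      field_simp
    have h5 : min μ (a / 2) * ‖x‖ ^ 2 ≤ μ * ‖x‖ ^ 2 := by gcongr; exact min_le_left _ _
    have h6 : min μ (a / 2) * (c * W) ≤ a / 2 * (c * W) := by gcongr; exact min_le_right _ _
    have h7 := mul_le_mul_of_nonneg_left h2 hc.le
    nlinarith

theorem IsHurwitz.exists_lyapunov {ι : Type*} [Fintype ι] [DecidableEq ι] {A : Matrix ι ι ℝ}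
    (hA : IsHurwitz A) :
    ∃ (V : (ι → ℝ) →L[ℝ] (ι → ℝ) →L[ℝ] ℝ) (a : ℝ), 0 < a ∧
      ∀ x, ‖x‖ ^ 2 ≤ V x x ∧ V x (A *ᵥ x) + V (A *ᵥ x) x ≤ -a * V x x := by
  set AC : Matrix ι ι ℂ := A.map (algebraMap ℝ ℂ) with hAC
  let T : EuclideanSpace ℂ ι →L[ℂ] EuclideanSpace ℂ ι := Matrix.toEuclideanCLM (𝕜 := ℂ) AC
  obtain ⟨s, hs⟩ := AC.charpoly.roots.exists_rep
  replace hs : (s : Multiset ℂ) = AC.charpoly.roots := hs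
  have hneg : ∀ l ∈ s, l.re < 0 := fun l hl => by
    refine hA l ?_
    rw [Matrix.mem_spectrum_iff_isRoot_charpoly]
    have : l ∈ AC.charpoly.roots := hs ▸ Multiset.mem_coe.2 hl
    exact (Polynomial.mem_roots'.1 this).2
  obtain ⟨V, a, ha, hV⟩ := exists_lyapunov_of_list T s hneg
  have hprod : (s.map fun l => T - l • (1 : EuclideanSpace ℂ ι →L[ℂ] EuclideanSpace ℂ ι)).prod
      = 0 := by
    have h1 : (s.map fun l => Polynomial.X - Polynomial.C l).prod = AC.charpoly := by
      rw [← Multiset.prod_coe, ← Multiset.map_coe, hs]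
      exact ((IsAlgClosed.splits AC.charpoly).eq_prod_roots_of_monic AC.charpoly_monic).symm
    have h2 : Polynomial.aeval T AC.charpoly = 0 := by
      have := Polynomial.aeval_algHom_apply
        (Matrix.toEuclideanCLM (n := ι) (𝕜 := ℂ)).toAlgEquiv.toAlgHom AC AC.charpoly
      rw [Matrix.aeval_self_charpoly, map_zero] at this
      exact this
    rw [← h1, map_list_prod, List.map_map] at h2
    rw [← h2]
    congr 2
    funext l
    simp [Algebra.algebraMap_eq_smul_one]
  -- the complexification `ℝ^ι → ℂ^ι`
  let J : (ι → ℝ) →L[ℝ] EuclideanSpace ℂ ι :=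
    LinearMap.toContinuousLinearMap
      { toFun := fun x => WithLp.toLp 2 fun i => (x i : ℂ)
        map_add' := fun x y => by ext i; simp
        map_smul' := fun r x => by ext i; simp }
  have hJ : ∀ x, J (A *ᵥ x) = T (J x) := fun x => by
    ext i
    simp [J, T, AC, Matrix.mulVec, dotProduct]
  refine ⟨V.bilinearComp J J, a, ha, fun x => ?_⟩
  obtain ⟨h1, h2⟩ := hV (J x) (by rw [hprod]; rfl)
  simp only [ContinuousLinearMap.bilinearComp_apply, hJ]
  refine ⟨le_trans ?_ h1, h2⟩
  gcongr
  refine (pi_norm_le_iff_of_nonneg (norm_nonneg _)).2 fun i => ?_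
  calc ‖x i‖ = ‖J x i‖ := by simp [J]
    _ ≤ ‖J x‖ := PiLp.norm_apply_le _ i

/-! ### Perturbed stable linear differential equations -/

/-- A scalar comparison principle. -/
theorem tendsto_zero_of_deriv_le {U U' g : ℝ → ℝ} {b T : ℝ} (hb : 0 < b) (hT : 0 ≤ T)
    (hU0 : ∀ t, 0 ≤ U t) (hU : ∀ t, 0 ≤ t → HasDerivWithinAt U (U' t) (Set.Ici 0) t)
    (hU' : ∀ t, T ≤ t → U' t ≤ -b * U t + g t) (hg : Tendsto g atTop (𝓝 0)) :
    Tendsto U atTop (𝓝 0) := by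
  rw [tendsto_order]
  refine ⟨fun r hr => .of_forall fun t => hr.trans_le (hU0 t), fun r hr => ?_⟩
  obtain ⟨T', hT'⟩ := eventually_atTop.1
    (hg.eventually (ge_mem_nhds (show 0 < b * (r / 2) by positivity)))
  set T₁ := max T T'
  have hanti : AntitoneOn (fun t => Real.exp (b * t) * (U t - r / 2)) (Set.Ici T₁) := by
    have hd : ∀ t, 0 ≤ t → HasDerivWithinAt (fun t => Real.exp (b * t) * (U t - r / 2))
        (Real.exp (b * t) * (b * 1) * (U t - r / 2) + Real.exp (b * t) * U' t) (Set.Ici 0) t :=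
      fun t ht => (((hasDerivWithinAt_id t _).const_mul b).exp).mul ((hU t ht).sub_const _)
    have h0 : Set.Ici T₁ ⊆ Set.Ici 0 := Set.Ici_subset_Ici.2 (hT.trans (le_max_left _ _))
    refine antitoneOn_of_hasDerivWithinAt_nonpos (convex_Ici T₁)
      (fun t ht => ((hd t (h0 ht)).mono h0).continuousWithinAt)
      (fun t ht => (hd t (h0 (interior_subset ht))).mono (interior_subset.trans h0))
      fun t ht => ?_
    have ht : T₁ ≤ t := interior_subset ht
    have h1 := hU' t ((le_max_left _ _).trans ht)
    have h2 := hT' t ((le_max_right _ _).trans ht)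
    have : Real.exp (b * t) * (b * 1) * (U t - r / 2) + Real.exp (b * t) * U' t =
      Real.exp (b * t) * (b * U t - b * (r / 2) + U' t) := by ring
    rw [this]
    exact mul_nonpos_of_nonneg_of_nonpos (Real.exp_pos _).le (by linarith)
  set c := Real.exp (b * T₁) * (U T₁ - r / 2)
  have hlim : Tendsto (fun t => c * Real.exp (-(b * t))) atTop (𝓝 0) := by
    have : Tendsto (fun t => b * t) atTop atTop := tendsto_id.const_mul_atTop hb
    simpa using (Real.tendsto_exp_neg_atTop_nhds_zero.comp this).const_mul c
  filter_upwards [hlim.eventually (gt_mem_nhds (half_pos hr)), eventually_ge_atTop T₁] with t h1 ht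
  have h2 : Real.exp (b * t) * (U t - r / 2) ≤ c := hanti Set.self_mem_Ici ht ht
  have h3 : U t - r / 2 ≤ c * Real.exp (-(b * t)) := by
    rw [Real.exp_neg, ← div_eq_mul_inv, le_div_iff₀ (Real.exp_pos _), mul_comm]
    exact h2
  linarith

/-- Vanishing perturbations, of the generator and of the forcing, do not destroy the convergence
to zero of the solutions of an equation with a quadratic Lyapunov function. -/
theorem tendsto_zero_of_lyapunov {E : Type*} [NormedAddCommGroup E] [NormedSpace ℝ E]
    {L : E → E} {V : E →L[ℝ] E →L[ℝ] ℝ} {a : ℝ} (ha : 0 < a)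
    (hV : ∀ x, ‖x‖ ^ 2 ≤ V x x ∧ V x (L x) + V (L x) x ≤ -a * V x x)
    {z f : ℝ → E} {P : ℝ → E →L[ℝ] E}
    (hz : ∀ t, 0 ≤ t → HasDerivWithinAt z (L (z t) + P t (z t) + f t) (Set.Ici 0) t)
    (hP : Tendsto P atTop (𝓝 0)) (hf : Tendsto f atTop (𝓝 0)) : Tendsto z atTop (𝓝 0) := by
  have hB : ∀ x y, V x y + V y x ≤ 2 * ‖V‖ * ‖x‖ * ‖y‖ := fun x y => by
    have h1 := (Real.le_norm_self _).trans (V.le_opNorm₂ x y)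
    have h2 := (Real.le_norm_self _).trans (V.le_opNorm₂ y x)
    nlinarith
  have hU : Tendsto (fun t => V (z t) (z t)) atTop (𝓝 0) := by
    have hsmall : ∀ᶠ t in atTop, 2 * ‖V‖ * ‖P t‖ < a / 4 := by
      have : Tendsto (fun t => 2 * ‖V‖ * ‖P t‖) atTop (𝓝 0) := by
        simpa using hP.norm.const_mul (2 * ‖V‖)
      exact this.eventually (gt_mem_nhds (by positivity))
    obtain ⟨T, hT⟩ := eventually_atTop.1 hsmall
    refine tendsto_zero_of_deriv_le (b := a / 2) (T := max T 0)
      (U' := fun t => V (z t) (L (z t) + P t (z t) + f t) + V (L (z t) + P t (z t) + f t) (z t))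
      (g := fun t => 4 * ‖V‖ ^ 2 / a * ‖f t‖ ^ 2)
      (half_pos ha) (le_max_right _ _) (fun t => (sq_nonneg _).trans (hV _).1)
      (fun t ht => ?_) (fun t ht => ?_) ?_
    · have h1 := hz t ht
      have h2 := (V.hasFDerivAt.comp_hasDerivWithinAt t h1).clm_apply h1
      rw [add_comm] at h2
      exact h2
    · obtain ⟨h1, h2⟩ := hV (z t)
      have h3 := hB (z t) (P t (z t))
      have h4 := hB (z t) (f t)
      have h5 := hT t ((le_max_left _ _).trans ht)
      have h6 : 2 * ‖V‖ * ‖z t‖ * ‖P t (z t)‖ ≤ a / 4 * V (z t) (z t) := by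
        calc 2 * ‖V‖ * ‖z t‖ * ‖P t (z t)‖ ≤ 2 * ‖V‖ * ‖z t‖ * (‖P t‖ * ‖z t‖) := by
              gcongr; exact (P t).le_opNorm _
          _ = 2 * ‖V‖ * ‖P t‖ * ‖z t‖ ^ 2 := by ring
          _ ≤ a / 4 * V (z t) (z t) := by gcongr
      have h7 : 2 * ‖V‖ * ‖z t‖ * ‖f t‖ ≤
          a / 4 * V (z t) (z t) + 4 * ‖V‖ ^ 2 / a * ‖f t‖ ^ 2 := by
        have h8 : 0 ≤ (a / 2 * ‖z t‖ - 2 * ‖V‖ * ‖f t‖) ^ 2 / a := by positivity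
        have h9 : (a / 2 * ‖z t‖ - 2 * ‖V‖ * ‖f t‖) ^ 2 / a =
            a / 4 * ‖z t‖ ^ 2 + 4 * ‖V‖ ^ 2 / a * ‖f t‖ ^ 2 - 2 * ‖V‖ * ‖z t‖ * ‖f t‖ := by
          field_simp
          ring
        have h10 : a / 4 * ‖z t‖ ^ 2 ≤ a / 4 * V (z t) (z t) := by gcongr
        linarith
      simp only [map_add, _root_.add_apply]
      linarith
    · simpa using (hf.norm.pow 2).const_mul (4 * ‖V‖ ^ 2 / a)
  rw [tendsto_zero_iff_norm_tendsto_zero]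
  have h1 : Tendsto (fun t => Real.sqrt (V (z t) (z t))) atTop (𝓝 0) := by
    simpa [Function.comp_def] using (Real.continuous_sqrt.tendsto 0).comp hU
  exact squeeze_zero (fun _ => norm_nonneg _) (fun t => Real.le_sqrt_of_sq_le (hV _).1) h1

theorem IsHurwitz.tendsto_zero {ι : Type*} [Fintype ι] [DecidableEq ι] {A : Matrix ι ι ℝ}
    (hA : IsHurwitz A) {z f : ℝ → ι → ℝ} {P : ℝ → Matrix ι ι ℝ}
    (hz : ∀ t, 0 ≤ t → HasDerivWithinAt z (A *ᵥ z t + P t *ᵥ z t + f t) (Set.Ici 0) t)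
    (hP : Tendsto P atTop (𝓝 0)) (hf : Tendsto f atTop (𝓝 0)) : Tendsto z atTop (𝓝 0) := by
  obtain ⟨V, a, ha, hV⟩ := hA.exists_lyapunov
  let Λ : Matrix ι ι ℝ →ₗ[ℝ] ((ι → ℝ) →L[ℝ] (ι → ℝ)) :=
    (LinearMap.toContinuousLinearMap :
      ((ι → ℝ) →ₗ[ℝ] (ι → ℝ)) ≃ₗ[ℝ] ((ι → ℝ) →L[ℝ] (ι → ℝ))).toLinearMap ∘ₗ
      (Matrix.toLin' : Matrix ι ι ℝ ≃ₗ[ℝ] _).toLinearMap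
  have hΛ : Continuous Λ := LinearMap.continuous_of_finiteDimensional Λ
  refine tendsto_zero_of_lyapunov (L := fun x => A *ᵥ x) ha hV (P := fun t => Λ (P t)) hz ?_ hf
  simpa [Function.comp_def] using (hΛ.tendsto 0).comp hP

theorem tendsto_zero_of_scalar {d : ℝ} (hd : 0 < d) {z f : ℝ → ℝ}
    (hz : ∀ t, 0 ≤ t → HasDerivWithinAt z (-d * z t + f t) (Set.Ici 0) t)
    (hf : Tendsto f atTop (𝓝 0)) : Tendsto z atTop (𝓝 0) := by
  refine tendsto_zero_of_lyapunov (L := fun x => -d * x) (V := ContinuousLinearMap.mul ℝ ℝ)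
    (a := d) hd (fun x => ⟨?_, ?_⟩) (P := fun _ => 0) (fun t ht => ?_) tendsto_const_nhds hf
  · simp [sq]
  · simp only [ContinuousLinearMap.mul_apply']
    nlinarith [mul_nonneg hd.le (mul_self_nonneg x)]
  · simpa using hz t ht

/-! ### The coupling of the observers -/

namespace CommGraph

variable {n m : ℕ} (G : CommGraph n m)

/-- The estimate by follower `j` concerning leader `k`, extended by zero to the followers that `k`
does not influence. -/
def extendZero {α : Type*} [Zero α] (z : ∀ i : Fin n, G.infLeaders i → α) (k : Fin m)
    (j : Fin n) : α :=
  open Classical in if h : k ∈ G.infLeaders j then z j ⟨k, h⟩ else 0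

/-- The diagonal entry of `H_k` at follower `i`: the total weight of the edges into `i` that come
from leader `k` or from followers influenced by `k`. -/
def observerDegree (i : Fin n) (k : Fin m) : ℝ :=
  open Classical in
  ∑ j ∈ G.nbrFollowers i, (if k ∈ G.infLeaders j then G.adj (Sum.inl i) (Sum.inl j) else 0)
    + G.adj (Sum.inl i) (Sum.inr k)

variable {G}

theorem observerDegree_pos {i : Fin n} {k : Fin m} (hk : k ∈ G.infLeaders i) :
    0 < G.observerDegree i k := by
  have h0 : ∀ j ∈ G.nbrFollowers i,
      0 ≤ (if k ∈ G.infLeaders j then G.adj (Sum.inl i) (Sum.inl j) else 0) := fun j _ => by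
    split_ifs
    exacts [G.nonneg _ _, le_rfl]
  rcases mem_infLeaders_iff.1 hk with h | ⟨j, hj, hkj⟩
  · exact add_pos_of_nonneg_of_pos (Finset.sum_nonneg h0) (mem_nbrLeaders.1 h)
  · refine add_pos_of_pos_of_nonneg (Finset.sum_pos' h0 ⟨j, hj, ?_⟩) (G.nonneg _ _)
    rw [if_pos hkj]
    exact mem_nbrFollowers.1 hj

/-- The coupling in terms of the estimation errors `z i k - r k`. -/
theorem coupling_eq {α : Type*} [AddCommGroup α] [Module ℝ α]
    (z : ∀ i : Fin n, G.infLeaders i → α) (r : Fin m → α) (i : Fin n) (k : G.infLeaders i) :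
    G.coupling z r i k =
      ∑ j ∈ G.nbrFollowers i, G.adj (Sum.inl i) (Sum.inl j) •
          G.extendZero (fun i k => z i k - r k.1) k.1 j
        - G.observerDegree i k.1 • (z i k - r k.1) := by
  have h1 : G.adj (Sum.inl i) (Sum.inr k.1) • (r k.1 - z i k) =
      -(G.adj (Sum.inl i) (Sum.inr k.1) • (z i k - r k.1)) := by rw [← smul_neg, neg_sub]
  rw [coupling, observerDegree, add_smul, Finset.sum_smul, ← sub_sub, ← Finset.sum_sub_distrib,
    h1, ← sub_eq_add_neg]
  congr 1
  refine Finset.sum_congr rfl fun j _ => ?_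
  unfold received extendZero
  split_ifs with h
  · rw [← smul_sub, sub_sub_sub_cancel_right]
  · simp

theorem mem_reachedBy {i : Fin n} {k : Fin m} : i ∈ G.reachedBy k ↔ k ∈ G.infLeaders i := by
  simp [reachedBy]

theorem sum_reachedBy_smul {α : Type*} [AddCommGroup α] [Module ℝ α] {k : Fin m} (i : Fin n)
    {w : Fin n → α} (hw : ∀ j, k ∉ G.infLeaders j → w j = 0) :
    ∑ j : G.reachedBy k, G.adj (Sum.inl i) (Sum.inl j.1) • w j.1 =
      ∑ j ∈ G.nbrFollowers i, G.adj (Sum.inl i) (Sum.inl j) • w j := by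
  rw [Finset.sum_coe_sort (G.reachedBy k) fun j => G.adj (Sum.inl i) (Sum.inl j) • w j,
    Finset.sum_subset (Finset.subset_univ _), ← Finset.sum_subset (Finset.subset_univ _)]
  · intro j _ hj
    rw [adj_eq_zero_of_notMem_nbrFollowers hj, zero_smul]
  · intro j _ hj
    rw [hw j fun h => hj (mem_reachedBy.2 h), smul_zero]

theorem sum_H_smul {α : Type*} [AddCommGroup α] [Module ℝ α]
    (z : ∀ i : Fin n, G.infLeaders i → α) (k : Fin m) (i : G.reachedBy k) :
    ∑ j : G.reachedBy k, G.H k i j • z j.1 ⟨k, mem_reachedBy.1 j.2⟩ =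
      G.observerDegree i.1 k • z i.1 ⟨k, mem_reachedBy.1 i.2⟩
        - ∑ j ∈ G.nbrFollowers i.1, G.adj (Sum.inl i.1) (Sum.inl j) • G.extendZero z k j := by
  have hz : ∀ j : G.reachedBy k, z j.1 ⟨k, mem_reachedBy.1 j.2⟩ = G.extendZero z k j.1 := fun j => by
    rw [extendZero, dif_pos]
  have hdeg : ∑ j : G.reachedBy k, G.adj (Sum.inl i.1) (Sum.inl j.1) +
      G.adj (Sum.inl i.1) (Sum.inr k) = G.observerDegree i.1 k := by
    classical
    have h1 := sum_reachedBy_smul (G := G) (k := k) i.1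
      (w := fun j => if k ∈ G.infLeaders j then (1 : ℝ) else 0) fun j hj => if_neg hj
    rw [observerDegree]
    congr 1
    convert h1 using 2 with j _ j _
    · rw [if_pos (mem_reachedBy.1 j.2), smul_eq_mul, mul_one]
    · simp
  simp only [hz]
  rw [← sum_reachedBy_smul (k := k) i.1 (w := G.extendZero z k)
    fun j hj => by rw [extendZero, dif_neg hj], ← hdeg]
  simp only [H, Matrix.add_apply, Matrix.sub_apply, of_apply, add_smul, sub_smul,
    Finset.sum_add_distrib, Finset.sum_sub_distrib, Matrix.diagonal_apply, ite_smul, zero_smul,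
    Finset.sum_ite_eq, Finset.mem_univ, if_true]
  abel

/-- A coupled family of scalar observers in an acyclic graph tracks its constant references at any
exponential rate smaller than all the diagonal entries of the coupling. -/
theorem Acyclic.tendsto_exp_mul_observer (h : G.Acyclic) {β ε : ℝ}
    (hε : ∀ i (k : G.infLeaders i), ε < β * G.observerDegree i k.1)
    {z : ℝ → ∀ i : Fin n, G.infLeaders i → ℝ} {r : Fin m → ℝ}
    (hz : ∀ t, 0 ≤ t → ∀ i (k : G.infLeaders i),
      HasDerivWithinAt (fun s => z s i k) (β * G.coupling (z t) r i k) (Set.Ici 0) t)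
    (i : Fin n) (k : G.infLeaders i) :
    Tendsto (fun t => Real.exp (ε * t) * (z t i k - r k.1)) atTop (𝓝 0) := by
  induction i using h.induction with
  | ih i ih =>
    refine tendsto_zero_of_scalar (d := β * G.observerDegree i k.1 - ε) (sub_pos.2 (hε i k))
      (f := fun t => ∑ j ∈ G.nbrFollowers i, β * G.adj (Sum.inl i) (Sum.inl j) *
        (Real.exp (ε * t) * G.extendZero (fun i k => z t i k - r k.1) k.1 j)) (fun t ht => ?_) ?_
    · have h1 := (((hasDerivWithinAt_id t (Set.Ici 0)).const_mul ε).exp).mul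
        ((hz t ht i k).sub_const (r k.1))
      rw [coupling_eq] at h1
      refine h1.congr_deriv ?_
      have h2 : ∑ j ∈ G.nbrFollowers i, β * G.adj (Sum.inl i) (Sum.inl j) *
          (Real.exp (ε * t) * G.extendZero (fun i k => z t i k - r k.1) k.1 j) =
          β * Real.exp (ε * t) * ∑ j ∈ G.nbrFollowers i, G.adj (Sum.inl i) (Sum.inl j) •
            G.extendZero (fun i k => z t i k - r k.1) k.1 j := by
        rw [Finset.mul_sum]
        exact Finset.sum_congr rfl fun j _ => by rw [smul_eq_mul]; ring
      rw [h2]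
      simp only [id_eq, smul_eq_mul]
      ring
    · rw [← Finset.sum_const_zero (s := G.nbrFollowers i)]
      refine tendsto_finsetSum _ fun j hj => ?_
      rw [← mul_zero (β * G.adj (Sum.inl i) (Sum.inl j))]
      refine Tendsto.const_mul _ ?_
      by_cases hk : k.1 ∈ G.infLeaders j
      · simpa [extendZero, hk] using ih j hj ⟨k.1, hk⟩
      · simp [extendZero, hk]

end CommGraph

/-! ### Eigenvectors and block matrices -/

theorem mem_spectrum_iff_exists_mulVec {ι : Type*} [Fintype ι] [DecidableEq ι] {A : Matrix ι ι ℂ}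
    {z : ℂ} : z ∈ spectrum ℂ A ↔ ∃ v : ι → ℂ, v ≠ 0 ∧ A *ᵥ v = z • v := by
  rw [← Matrix.spectrum_toLin', ← Module.End.hasEigenvalue_iff_mem_spectrum]
  constructor
  · intro h
    obtain ⟨v, hv⟩ := h.exists_hasEigenvector
    exact ⟨v, hv.2, by simpa using hv.apply_eq_smul⟩
  · rintro ⟨v, hv, h⟩
    exact Module.End.hasEigenvalue_of_hasEigenvector
      (Module.End.hasEigenvector_iff.2 ⟨Module.End.mem_eigenspace_iff.2 (by simpa using h), hv⟩)

theorem map_mulVec_apply {ι κ : Type*} [Fintype κ] (A : Matrix ι κ ℝ) (v : κ → ℂ) (i : ι) :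
    (A.map (algebraMap ℝ ℂ) *ᵥ v) i = ∑ j, A i j • v j := by
  simp [Matrix.mulVec, dotProduct]

theorem IsMarginallyStable.isHurwitz_sub {ι : Type*} [Fintype ι] [DecidableEq ι]
    {S : Matrix ι ι ℝ} (hS : IsMarginallyStable S) {ε : ℝ} (hε : 0 < ε) :
    IsHurwitz (S - ε • (1 : Matrix ι ι ℝ)) := by
  intro z hz
  obtain ⟨v, hv, h⟩ := mem_spectrum_iff_exists_mulVec.1 hz
  have h1 : z + ε ∈ spectrum ℂ (S.map (algebraMap ℝ ℂ)) := by
    refine mem_spectrum_iff_exists_mulVec.2 ⟨v, hv, ?_⟩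
    have h2 : (S - ε • (1 : Matrix ι ι ℝ)).map (algebraMap ℝ ℂ) =
        S.map (algebraMap ℝ ℂ) - (ε : ℂ) • (1 : Matrix ι ι ℂ) := by
      ext i j
      by_cases h : i = j <;> simp [h]
    rw [h2, Matrix.sub_mulVec, Matrix.smul_mulVec, Matrix.one_mulVec] at h
    rw [add_smul, ← h, sub_add_cancel]
  have := (hS _ h1).1
  simp only [Complex.add_re, Complex.ofReal_re] at this
  linarith

theorem blockDiagonal'_mulVec_apply {R ι : Type*} [CommRing R] [Fintype ι] [DecidableEq ι]
    {α β : ι → Type*} [∀ i, Fintype (β i)] (M : ∀ i, Matrix (α i) (β i) R)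
    (v : (Σ i, β i) → R) (i : ι) (a : α i) :
    (Matrix.blockDiagonal' M *ᵥ v) ⟨i, a⟩ = (M i *ᵥ fun b => v ⟨i, b⟩) a := by
  simp only [Matrix.mulVec, dotProduct]
  rw [Fintype.sum_sigma, Finset.sum_eq_single i]
  · simp
  · intro j _ hj
    simp [Matrix.blockDiagonal'_apply_ne M _ _ hj.symm]
  · simp

theorem blkDiag_mulVec_apply {κ α β : Type*} [Fintype κ] [DecidableEq κ] [Fintype β]
    (M : κ → Matrix α β ℝ) (v : κ × β → ℝ) (k : κ) (a : α) :
    (blkDiag M *ᵥ v) (k, a) = (M k *ᵥ fun b => v (k, b)) a := by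
  simp only [Matrix.mulVec, dotProduct, blkDiag, submatrix_apply, Prod.swap_prod_mk,
    Matrix.blockDiagonal_apply, ite_mul, zero_mul]
  rw [Fintype.sum_prod_type, Finset.sum_eq_single k]
  · simp
  · intro j _ hj
    simp [hj.symm]
  · simp

theorem rowKron_mul_blkDiag_mulVec {κ : Type*} [Fintype κ] [DecidableEq κ] {Q q : ℕ} (v : κ → ℝ)
    (D : κ → Matrix (Fin Q) (Fin q) ℝ) (w : κ × Fin q → ℝ) :
    (rowKron v Q * blkDiag D) *ᵥ w = ∑ k, v k • (D k *ᵥ fun c => w (k, c)) := by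
  funext r
  rw [← Matrix.mulVec_mulVec, Finset.sum_apply, Matrix.mulVec, dotProduct, Fintype.sum_prod_type]
  refine Finset.sum_congr rfl fun k _ => ?_
  rw [Finset.sum_eq_single r]
  · simp [rowKron, blkDiag_mulVec_apply]
  · intro s _ hs
    simp [rowKron, Matrix.one_apply_ne hs.symm]
  · simp

namespace MultiAgentSystem

variable {n m q Q : ℕ} {M : MultiAgentSystem n m q Q}

/-! ### The closed-loop matrices -/

/-- The lower right block of `A_C` acts on the estimation errors like the leaders' dynamics plus
the coupling. -/
theorem sum_Theta_smul {α : Type*} [AddCommGroup α] [Module ℝ α] (β : ℝ) (z : M.IdxEta → α)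
    (i : Fin n) (k : M.G.infLeaders i) (r : Fin q) :
    ∑ p, ((M.Theta β).submatrix (M.G.regroup q) (M.G.regroup q)) ⟨i, k, r⟩ p • z p =
      ∑ c, M.S k.1 r c • z ⟨i, k, c⟩ -
        β • (M.G.observerDegree i k.1 • z ⟨i, k, r⟩ -
          ∑ j ∈ M.G.nbrFollowers i, M.G.adj (Sum.inl i) (Sum.inl j) •
            M.G.extendZero (fun i k => z ⟨i, k, r⟩) k.1 j) := by
  have h1 : ∑ p, ((M.Theta β).submatrix (M.G.regroup q) (M.G.regroup q)) ⟨i, k, r⟩ p • z p =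
      ∑ s, M.Theta β (M.G.regroup q ⟨i, k, r⟩) s • z ((M.G.regroup q).symm s) := by
    rw [← (M.G.regroup q).sum_comp]
    simp
  have hi : i ∈ M.G.reachedBy k.1 := CommGraph.mem_reachedBy.2 k.2
  have h2 : M.G.regroup q ⟨i, k, r⟩ = ⟨k.1, ⟨i, hi⟩, r⟩ := rfl
  have h3 := CommGraph.sum_H_smul (fun i k => z ⟨i, k, r⟩) k.1 ⟨i, hi⟩
  rw [h1, h2, ← h3, Fintype.sum_sigma, Finset.sum_eq_single k.1]
  · rw [Fintype.sum_prod_type]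
    simp only [Theta, Matrix.blockDiagonal'_apply_eq, Matrix.sub_apply, Matrix.smul_apply,
      Matrix.kroneckerMap_apply, sub_smul, Finset.sum_sub_distrib, smul_eq_mul, Finset.smul_sum]
    congr 1
    · rw [Finset.sum_eq_single ⟨i, hi⟩]
      · simp [CommGraph.regroup]
      · intro j _ hj
        simp [Matrix.one_apply_ne hj.symm]
      · simp
    · refine Finset.sum_congr rfl fun j _ => ?_
      rw [Finset.sum_eq_single r]
      · simp [CommGraph.regroup, mul_smul]
      · intro c _ hc
        simp [Matrix.one_apply_ne hc.symm]
      · simp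
  · intro l _ hl
    refine Finset.sum_eq_zero fun x _ => ?_
    rw [Theta, Matrix.blockDiagonal'_apply_ne _ _ _ hl.symm, zero_smul]
  · simp

theorem Theta_add_ThetaBar (β : ℝ) :
    (M.Theta β).submatrix (M.G.regroup q) (M.G.regroup q) +
      (M.ThetaBar β).submatrix (M.G.regroup q) (M.G.regroup q) = M.SRstack := by
  have h : M.Theta β + M.ThetaBar β = Matrix.blockDiagonal' fun k =>
      (1 : Matrix (M.G.reachedBy k) (M.G.reachedBy k) ℝ) ⊗ₖ M.S k := by
    rw [Theta, ThetaBar, ← Matrix.blockDiagonal'_add]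
    congr 1
    funext k
    exact sub_add_cancel _ _
  have h' : (M.Theta β).submatrix (M.G.regroup q) (M.G.regroup q) +
      (M.ThetaBar β).submatrix (M.G.regroup q) (M.G.regroup q) =
      (M.Theta β + M.ThetaBar β).submatrix (M.G.regroup q) (M.G.regroup q) := rfl
  rw [h', h]
  ext ⟨i, k, r⟩ ⟨j, l, c⟩
  rw [Matrix.submatrix_apply, SRstack]
  by_cases hkl : k.1 = l.1
  · obtain ⟨k, hk⟩ := k
    obtain ⟨l, hl⟩ := l
    obtain rfl : k = l := hkl
    by_cases hij : i = j
    · subst hij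
      simp [CommGraph.regroup, SR, blkDiag]
    · rw [Matrix.blockDiagonal'_apply_ne _ _ _ hij]
      have h4 : (⟨i, CommGraph.mem_reachedBy.2 hk⟩ : M.G.reachedBy k) ≠
          ⟨j, CommGraph.mem_reachedBy.2 hl⟩ := fun h => hij (congrArg Subtype.val h)
      simp [CommGraph.regroup, Matrix.one_apply_ne h4]
  · have h3 : (M.G.regroup q ⟨i, k, r⟩).1 ≠ (M.G.regroup q ⟨j, l, c⟩).1 := hkl
    rw [Matrix.blockDiagonal'_apply_ne _ _ _ h3]
    by_cases hij : i = j
    · subst hij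
      have : k ≠ l := fun h => hkl (congrArg _ h)
      simp [SR, blkDiag, Matrix.blockDiagonal_apply, this]
    · rw [Matrix.blockDiagonal'_apply_ne _ _ _ hij]

/-- An eigenvector for an eigenvalue `z` with `0 ≤ Re z` would vanish: at a follower whose
follower neighbors carry no component, the observer component would be an eigenvector of `S_k` for
`z + β d` with `β d > 0`, and then the follower component would be one of `A_i + B_i K_i`. -/
theorem isHurwitz_AC (hacyclic : M.G.Acyclic) (hleaders : ∀ k, IsMarginallyStable (M.S k))
    {K1 : ∀ i, Matrix (Fin (M.dimU i)) (Fin (M.dimX i)) ℝ}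
    (hK1 : ∀ i, IsHurwitz (M.A i + M.B i * K1 i))
    (K2 : ∀ i, Matrix (Fin (M.dimU i)) (M.G.infLeaders i × Fin q) ℝ) {β : ℝ} (hβ : 0 < β) :
    IsHurwitz (M.AC K1 K2 β) := by
  intro z hz
  obtain ⟨v, hv, h⟩ := mem_spectrum_iff_exists_mulVec.1 hz
  by_contra hre
  refine hv ?_
  have hv2 : ∀ i (k : M.G.infLeaders i) (r : Fin q), v (Sum.inr ⟨i, k, r⟩) = 0 := by
    intro i
    induction i using hacyclic.induction with
    | ih i ih =>
      intro k
      by_contra hne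
      have hmem : z + (β * M.G.observerDegree i k.1 : ℝ) ∈
          spectrum ℂ ((M.S k.1).map (algebraMap ℝ ℂ)) := by
        refine mem_spectrum_iff_exists_mulVec.2 ⟨fun r => v (Sum.inr ⟨i, k, r⟩), fun h0 =>
          hne fun r => congrFun h0 r, ?_⟩
        funext r
        have h1 := congrFun h (Sum.inr ⟨i, k, r⟩)
        rw [map_mulVec_apply, Fintype.sum_sum_type] at h1
        simp only [AC, fromBlocks_apply₂₁, fromBlocks_apply₂₂, Matrix.zero_apply, zero_smul,
          Finset.sum_const_zero, zero_add] at h1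
        rw [sum_Theta_smul β fun p => v (Sum.inr p),
          Finset.sum_eq_zero (s := M.G.nbrFollowers i), sub_zero] at h1
        · rw [map_mulVec_apply, sub_eq_iff_eq_add.1 h1]
          simp only [Pi.smul_apply, smul_eq_mul, Complex.real_smul, Complex.ofReal_mul]
          ring
        · intro j hj
          by_cases hk : k.1 ∈ M.G.infLeaders j
          · simp [CommGraph.extendZero, hk, ih j hj]
          · simp [CommGraph.extendZero, hk]
      have h2 := (hleaders k.1 _ hmem).1
      have h3 := mul_pos hβ (CommGraph.observerDegree_pos k.2)
      simp only [Complex.add_re, Complex.ofReal_re] at h2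
      exact hre (by linarith)
  have hv1 : ∀ i p, v (Sum.inl ⟨i, p⟩) = 0 := by
    intro i
    by_contra hne
    have hmem : z ∈ spectrum ℂ ((M.A i + M.B i * K1 i).map (algebraMap ℝ ℂ)) := by
      refine mem_spectrum_iff_exists_mulVec.2 ⟨fun p => v (Sum.inl ⟨i, p⟩), fun h0 =>
        hne fun r => congrFun h0 r, ?_⟩
      funext p
      have h1 := congrFun h (Sum.inl ⟨i, p⟩)
      rw [map_mulVec_apply, Fintype.sum_sum_type] at h1
      have h2 : ∀ x : M.IdxEta, v (Sum.inr x) = 0 := fun x => hv2 _ _ _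
      simp only [AC, fromBlocks_apply₁₁, h2, smul_zero, Finset.sum_const_zero, add_zero,
        ← Matrix.blockDiagonal'_mul, ← Matrix.blockDiagonal'_add] at h1
      rw [← map_mulVec_apply _ (fun x => v (Sum.inl x)), Matrix.blockDiagonal'_map _ _ (map_zero _),
        blockDiagonal'_mulVec_apply] at h1
      exact h1
    exact hre (hK1 i z hmem)
  funext x
  rcases x with ⟨i, p⟩ | ⟨i, k, r⟩
  exacts [hv1 i p, hv2 i k r]

/-! ### The steady state of the closed loop -/

/-- The graph `x_i = Π_i Ω_i`, `η = Ω` of the steady state over the leaders' states. -/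
def steadyState (M : MultiAgentSystem n m q Q)
    (Pi : ∀ i, Matrix (Fin (M.dimX i)) (M.G.infLeaders i × Fin q) ℝ) :
    Matrix (M.IdxX ⊕ M.IdxEta) M.IdxEta ℝ :=
  Matrix.fromRows (Matrix.blockDiagonal' Pi) 1

section Regulator

variable {Pi : ∀ i, Matrix (Fin (M.dimX i)) (M.G.infLeaders i × Fin q) ℝ}
  {Ga : ∀ i, Matrix (Fin (M.dimU i)) (M.G.infLeaders i × Fin q) ℝ}
  {K1 : ∀ i, Matrix (Fin (M.dimU i)) (Fin (M.dimX i)) ℝ}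
  {K2 : ∀ i, Matrix (Fin (M.dimU i)) (M.G.infLeaders i × Fin q) ℝ}

/-- The graph of the steady state is invariant. -/
theorem steadyState_mul_SRstack (hreg : ∀ i, M.SolvesRegulator i (Pi i) (Ga i))
    (hK2 : ∀ i, K2 i = Ga i - K1 i * Pi i) (β : ℝ) :
    M.steadyState Pi * M.SRstack = M.AC K1 K2 β * M.steadyState Pi + M.BC β := by
  have h1 : Matrix.blockDiagonal' Pi * M.SRstack =
      (Matrix.blockDiagonal' M.A + Matrix.blockDiagonal' M.B * Matrix.blockDiagonal' K1) *
        Matrix.blockDiagonal' Pi + Matrix.blockDiagonal' M.B * Matrix.blockDiagonal' K2 := by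
    simp only [SRstack, ← Matrix.blockDiagonal'_mul, ← Matrix.blockDiagonal'_add]
    congr 1
    funext i
    simp only [_root_.Pi.add_apply]
    rw [(hreg i).1, hK2 i, Matrix.add_mul, Matrix.mul_sub, Matrix.mul_assoc]
    abel
  rw [steadyState, AC, BC, Matrix.fromRows_mul, Matrix.fromBlocks_mul_fromRows, h1,
    ← Theta_add_ThetaBar β]
  ext (a | a) b <;> simp

theorem CC_mul_steadyState (hreg : ∀ i, M.SolvesRegulator i (Pi i) (Ga i)) :
    M.CC * M.steadyState Pi + M.DC = 0 := by
  rw [CC, steadyState, DC, Matrix.fromCols_mul_fromRows, Matrix.zero_mul, add_zero,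
    ← sub_eq_add_neg, ← Matrix.blockDiagonal'_mul, ← Matrix.blockDiagonal'_mul,
    ← Matrix.blockDiagonal'_sub, ← Matrix.blockDiagonal'_zero]
  congr 1
  funext i
  exact (hreg i).2.symm

/-- The deviation from the steady state obeys the perturbed linear equation with matrix `A_C`, and
the error is a linear function of the deviation. -/
theorem tendsto_stackedError (hreg : ∀ i, M.SolvesRegulator i (Pi i) (Ga i))
    (hK2 : ∀ i, K2 i = Ga i - K1 i * Pi i) {β : ℝ} (hAC : IsHurwitz (M.AC K1 K2 β))
    {X : ℝ → M.IdxX ⊕ M.IdxEta → ℝ} {Ω : ℝ → M.IdxEta → ℝ}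
    {P : ℝ → Matrix (M.IdxX ⊕ M.IdxEta) (M.IdxX ⊕ M.IdxEta) ℝ}
    (hΩ : ∀ t, 0 ≤ t → HasDerivWithinAt Ω (M.SRstack *ᵥ Ω t) (Set.Ici 0) t)
    (hX : ∀ t, 0 ≤ t → HasDerivWithinAt X
      (M.AC K1 K2 β *ᵥ X t + M.BC β *ᵥ Ω t + P t *ᵥ X t) (Set.Ici 0) t)
    (hP : Tendsto P atTop (𝓝 0))
    (hPΩ : Tendsto (fun t => P t *ᵥ (M.steadyState Pi *ᵥ Ω t)) atTop (𝓝 0)) :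
    Tendsto (fun t => M.stackedError (X t) (Ω t)) atTop (𝓝 0) := by
  set T := M.steadyState Pi with hT
  have hTΩ : ∀ t, 0 ≤ t →
      HasDerivWithinAt (fun t => T *ᵥ Ω t) (T *ᵥ (M.SRstack *ᵥ Ω t)) (Set.Ici 0) t := fun t ht =>
    (LinearMap.toContinuousLinearMap T.mulVecLin).hasFDerivAt.comp_hasDerivWithinAt t (hΩ t ht)
  have hz : Tendsto (fun t => X t - T *ᵥ Ω t) atTop (𝓝 0) := by
    refine hAC.tendsto_zero (fun t ht => ((hX t ht).sub (hTΩ t ht)).congr_deriv ?_) hP hPΩ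
    rw [Matrix.mulVec_mulVec, steadyState_mul_SRstack hreg hK2 β, Matrix.add_mulVec,
      ← Matrix.mulVec_mulVec, Matrix.mulVec_sub, Matrix.mulVec_sub]
    abel
  have hE : ∀ t, M.stackedError (X t) (Ω t) = M.CC *ᵥ (X t - T *ᵥ Ω t) := fun t => by
    rw [stackedError, eq_neg_of_add_eq_zero_right (CC_mul_steadyState hreg), Matrix.neg_mulVec,
      ← Matrix.mulVec_mulVec, Matrix.mulVec_sub, sub_eq_add_neg]
  simp only [hE]
  have hc : Continuous fun x : M.IdxX ⊕ M.IdxEta → ℝ => M.CC *ᵥ x :=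
    continuous_const.matrix_mulVec continuous_id
  simpa [Function.comp_def] using (hc.tendsto 0).comp hz

end Regulator

/-! ### The adaptive closed loop -/

/-- The perturbation of the closed-loop matrix by the errors of the estimates of the leaders'
matrices. -/
def perturbation (M : MultiAgentSystem n m q Q)
    (F : ∀ i, M.G.infLeaders i → Matrix (Fin q) (Fin q) ℝ) :
    Matrix (M.IdxX ⊕ M.IdxEta) (M.IdxX ⊕ M.IdxEta) ℝ :=
  Matrix.fromBlocks 0 0 0 (Matrix.blockDiagonal' fun i => blkDiag (F i))

theorem perturbation_zero : M.perturbation 0 = 0 := by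
  have h : (fun i => blkDiag ((0 : ∀ i, M.G.infLeaders i → Matrix (Fin q) (Fin q) ℝ) i)) = 0 := by
    funext i
    simp only [blkDiag, Pi.zero_apply]
    rw [Matrix.blockDiagonal_zero]
    rfl
  rw [perturbation, h, Matrix.blockDiagonal'_zero, Matrix.fromBlocks_zero]

theorem continuous_perturbation : Continuous M.perturbation := by
  refine continuous_const.matrix_fromBlocks continuous_const continuous_const
    (Continuous.matrix_blockDiagonal' (continuous_pi fun i => ?_))
  exact ((continuous_apply i).matrix_blockDiagonal).matrix_submatrix _ _

theorem perturbation_mulVec_inl (F : ∀ i, M.G.infLeaders i → Matrix (Fin q) (Fin q) ℝ)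
    (v : M.IdxX ⊕ M.IdxEta → ℝ) (p : M.IdxX) : (M.perturbation F *ᵥ v) (Sum.inl p) = 0 := by
  simp [perturbation, Matrix.fromBlocks_mulVec]

theorem perturbation_mulVec_inr (F : ∀ i, M.G.infLeaders i → Matrix (Fin q) (Fin q) ℝ)
    (v : M.IdxX ⊕ M.IdxEta → ℝ) (i : Fin n) (k : M.G.infLeaders i) (r : Fin q) :
    (M.perturbation F *ᵥ v) (Sum.inr ⟨i, k, r⟩) =
      (F i k *ᵥ fun c => v (Sum.inr ⟨i, k, c⟩)) r := by
  rw [perturbation, Matrix.fromBlocks_mulVec, Sum.elim_inr, Matrix.zero_mulVec, zero_add,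
    blockDiagonal'_mulVec_apply, blkDiag_mulVec_apply]
  rfl

section Trajectory

variable {K1 : ∀ i, Matrix (Fin (M.dimU i)) (Fin (M.dimX i)) ℝ}
  {K2 : ∀ i, Matrix (Fin (M.dimU i)) (M.G.infLeaders i × Fin q) ℝ} {βη βS βD : ℝ}
  {ω : ℝ → Fin m → Fin q → ℝ} {x : ℝ → ∀ i, Fin (M.dimX i) → ℝ}
  {η : ℝ → ∀ i, M.G.infLeaders i → Fin q → ℝ}
  {Sh : ℝ → ∀ i, M.G.infLeaders i → Matrix (Fin q) (Fin q) ℝ}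
  {Dh : ℝ → ∀ i, M.G.infLeaders i → Matrix (Fin Q) (Fin q) ℝ}

theorem SRstack_mulVec_apply (v : M.IdxEta → ℝ) (i : Fin n) (k : M.G.infLeaders i) (r : Fin q) :
    (M.SRstack *ᵥ v) ⟨i, k, r⟩ = (M.S k.1 *ᵥ fun c => v ⟨i, k, c⟩) r := by
  rw [SRstack, blockDiagonal'_mulVec_apply, SR, blkDiag_mulVec_apply]

theorem IsTrajectory.hasDerivWithinAt_Omega (h : M.IsTrajectory K1 K2 βη βS βD ω x η Sh Dh) {t : ℝ}
    (ht : 0 ≤ t) : HasDerivWithinAt (fun t => M.Omega (ω t)) (M.SRstack *ᵥ M.Omega (ω t))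
      (Set.Ici 0) t := by
  rw [hasDerivWithinAt_pi]
  rintro ⟨i, k, r⟩
  rw [SRstack_mulVec_apply]
  exact (hasDerivWithinAt_pi.1 (h.leader t ht k.1)) r

/-- The closed loop is a perturbation, by the errors of the estimates of the leaders' matrices, of
the closed loop with exact estimates. -/
theorem IsTrajectory.hasDerivWithinAt_stateC (h : M.IsTrajectory K1 K2 βη βS βD ω x η Sh Dh) {t : ℝ}
    (ht : 0 ≤ t) : HasDerivWithinAt (fun t => M.stateC (x t) (η t))
      (M.AC K1 K2 βη *ᵥ M.stateC (x t) (η t) + M.BC βη *ᵥ M.Omega (ω t) +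
        M.perturbation (fun i k => Sh t i k - M.S k.1) *ᵥ M.stateC (x t) (η t)) (Set.Ici 0) t := by
  rw [hasDerivWithinAt_pi]
  rintro (⟨i, p⟩ | ⟨i, k, r⟩)
  · refine ((hasDerivWithinAt_pi.1 (h.follower t ht i)) p).congr_deriv ?_
    simp only [Pi.add_apply, perturbation_mulVec_inl, AC, BC, Matrix.fromBlocks_mulVec,
      Matrix.fromRows_mulVec, Sum.elim_inl, Matrix.zero_mulVec, Pi.zero_apply, add_zero,
      ← Matrix.blockDiagonal'_mul, ← Matrix.blockDiagonal'_add, blockDiagonal'_mulVec_apply,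
      control, Matrix.mulVec_add, Matrix.add_mulVec, Matrix.mulVec_mulVec]
    rw [add_assoc]
    rfl
  · refine ((hasDerivWithinAt_pi.1 (h.observer_state t ht i k)) r).congr_deriv ?_
    have hTheta : (M.ThetaBar βη).submatrix (M.G.regroup q) (M.G.regroup q) =
        M.SRstack - (M.Theta βη).submatrix (M.G.regroup q) (M.G.regroup q) :=
      eq_sub_of_add_eq' (Theta_add_ThetaBar βη)
    have hη : M.stateC (x t) (η t) ∘ Sum.inr = fun p => η t p.1 p.2.1 p.2.2 := rfl
    have h1 : (M.AC K1 K2 βη *ᵥ M.stateC (x t) (η t) + M.BC βη *ᵥ M.Omega (ω t))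
        (Sum.inr ⟨i, k, r⟩) =
        ((M.Theta βη).submatrix (M.G.regroup q) (M.G.regroup q) *ᵥ
          fun p => η t p.1 p.2.1 p.2.2 - M.Omega (ω t) p) ⟨i, k, r⟩ +
          (M.SRstack *ᵥ M.Omega (ω t)) ⟨i, k, r⟩ := by
      have h2 : (fun p => η t p.1 p.2.1 p.2.2 - M.Omega (ω t) p) =
        (fun p : M.IdxEta => η t p.1 p.2.1 p.2.2) - M.Omega (ω t) := rfl
      rw [Pi.add_apply, AC, BC, Matrix.fromBlocks_mulVec, Matrix.fromRows_mulVec, Sum.elim_inr,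
        Sum.elim_inr, hTheta, Matrix.zero_mulVec, zero_add, Matrix.sub_mulVec, hη, h2,
        Matrix.mulVec_sub, Pi.sub_apply, Pi.sub_apply]
      ring
    have h3 := sum_Theta_smul βη (fun p => η t p.1 p.2.1 p.2.2 - M.Omega (ω t) p) i k r
    have h4 : (M.G.coupling (η t) (ω t) i k) r =
        M.G.coupling (fun i k => η t i k r) (fun k => ω t k r) i k := by
      simp only [CommGraph.coupling, Pi.add_apply, Finset.sum_apply, Pi.smul_apply, Pi.sub_apply]
      congr 1
      refine Finset.sum_congr rfl fun j _ => ?_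
      unfold CommGraph.received
      split_ifs <;> rfl
    rw [Pi.add_apply, Pi.add_apply, h1, perturbation_mulVec_inr, SRstack_mulVec_apply,
      Pi.smul_apply, h4, CommGraph.coupling_eq, Matrix.sub_mulVec, Pi.sub_apply]
    have h5 : (M.S k.1 *ᵥ fun c => η t i k c) r - (M.S k.1 *ᵥ fun c => ω t k.1 c) r =
        ∑ c, M.S k.1 r c • (η t i k c - ω t k.1 c) := by
      rw [← Pi.sub_apply, ← Matrix.mulVec_sub]
      rfl
    have h6 : ((M.Theta βη).submatrix (M.G.regroup q) (M.G.regroup q) *ᵥ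
          fun p => η t p.1 p.2.1 p.2.2 - M.Omega (ω t) p) ⟨i, k, r⟩ = _ := h3
    rw [h6]
    simp only [stateC, Sum.elim_inr, Omega, smul_eq_mul] at h5 ⊢
    linear_combination h5

/-- The estimates of the leaders' matrices converge exponentially, which outweighs the at most
subexponential growth of the leaders' states. -/
theorem IsTrajectory.exists_rate (h : M.IsTrajectory K1 K2 βη βS βD ω x η Sh Dh)
    (hacyclic : M.G.Acyclic) (hleaders : ∀ k, IsMarginallyStable (M.S k)) (hβS : 0 < βS) :
    ∃ ε : ℝ, 0 < ε ∧
      (∀ i (k : M.G.infLeaders i) r c,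
        Tendsto (fun t => Real.exp (ε * t) * (Sh t i k r c - M.S k.1 r c)) atTop (𝓝 0)) ∧
      ∀ k, Tendsto (fun t => Real.exp (-ε * t) • ω t k) atTop (𝓝 0) := by
  have h1 : ∀ᶠ ε : ℝ in 𝓝[>] 0, ∀ i, ∀ k : M.G.infLeaders i,
      ε < βS * M.G.observerDegree i k.1 := by
    refine eventually_all.2 fun i => eventually_all.2 fun k => ?_
    exact nhdsWithin_le_nhds
      (gt_mem_nhds (mul_pos hβS (CommGraph.observerDegree_pos k.2)))
  obtain ⟨ε, hε, hpos⟩ := (h1.and self_mem_nhdsWithin).exists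
  replace hpos : 0 < ε := hpos
  refine ⟨ε, hpos, fun i k r c => ?_, fun k => ?_⟩
  · refine hacyclic.tendsto_exp_mul_observer hε (z := fun t i k => Sh t i k r c)
      (r := fun k => M.S k r c) (fun t ht i k => (h.observer_S t ht i k r c).congr_deriv ?_) i k
    rw [Matrix.smul_apply, smul_eq_mul]
    congr 1
    simp only [CommGraph.coupling, Matrix.add_apply, Matrix.sum_apply, Matrix.smul_apply,
      Matrix.sub_apply]
    congr 1
    refine Finset.sum_congr rfl fun j _ => ?_
    unfold CommGraph.received
    split_ifs <;> rfl
  · refine ((hleaders k).isHurwitz_sub hpos).tendsto_zero (P := fun _ => 0) (f := fun _ => 0)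
      (fun t ht => ?_) tendsto_const_nhds tendsto_const_nhds
    have h2 := (((hasDerivWithinAt_id t (Set.Ici 0)).const_mul (-ε)).exp).smul (h.leader t ht k)
    refine h2.congr_deriv ?_
    rw [Matrix.zero_mulVec, add_zero, add_zero, Matrix.sub_mulVec, Matrix.mulVec_smul,
      Matrix.smul_mulVec, Matrix.one_mulVec, smul_smul]
    simp only [id_eq]
    module

theorem IsTrajectory.tendsto_stackedError (h : M.IsTrajectory K1 K2 βη βS βD ω x η Sh Dh)
    (hacyclic : M.G.Acyclic) (hleaders : ∀ k, IsMarginallyStable (M.S k))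
    {Pi : ∀ i, Matrix (Fin (M.dimX i)) (M.G.infLeaders i × Fin q) ℝ}
    {Ga : ∀ i, Matrix (Fin (M.dimU i)) (M.G.infLeaders i × Fin q) ℝ}
    (hreg : ∀ i, M.SolvesRegulator i (Pi i) (Ga i))
    (hK2 : ∀ i, K2 i = Ga i - K1 i * Pi i) (hAC : IsHurwitz (M.AC K1 K2 βη)) (hβS : 0 < βS) :
    Tendsto (fun t => M.stackedError (M.stateC (x t) (η t)) (M.Omega (ω t))) atTop (𝓝 0) := by
  obtain ⟨ε, hε, hS, hω⟩ := h.exists_rate hacyclic hleaders hβS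
  refine MultiAgentSystem.tendsto_stackedError hreg hK2 hAC (Ω := fun t => M.Omega (ω t))
    (fun t ht => h.hasDerivWithinAt_Omega ht) (fun t ht => h.hasDerivWithinAt_stateC ht) ?_ ?_
  · have h0 : Tendsto (fun t i (k : M.G.infLeaders i) => Sh t i k - M.S k.1) atTop (𝓝 0) := by
      refine tendsto_pi_nhds.2 fun i => tendsto_pi_nhds.2 fun k => tendsto_pi_nhds.2 fun r =>
        tendsto_pi_nhds.2 fun c => ?_
      have h1 : Tendsto (fun t : ℝ => Real.exp (-(ε * t))) atTop (𝓝 0) :=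
        Real.tendsto_exp_neg_atTop_nhds_zero.comp (tendsto_id.const_mul_atTop hε)
      have h2 := h1.mul (hS i k r c)
      simp only [← mul_assoc, ← Real.exp_add, neg_add_cancel, Real.exp_zero, one_mul, mul_zero]
        at h2
      exact h2
    have h1 := (continuous_perturbation (M := M)).tendsto 0
    rw [perturbation_zero] at h1
    exact h1.comp h0
  · refine tendsto_pi_nhds.2 ?_
    rintro (p | ⟨i, k, r⟩)
    · simp only [perturbation_mulVec_inl]
      exact tendsto_const_nhds
    · simp only [perturbation_mulVec_inr, steadyState, Matrix.fromRows_mulVec, Sum.elim_inr,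
        Matrix.one_mulVec]
      simp only [Matrix.mulVec, dotProduct, Matrix.sub_apply, Omega, _root_.Pi.zero_apply]
      rw [← Finset.sum_const_zero (s := (Finset.univ : Finset (Fin q)))]
      refine tendsto_finsetSum _ fun c _ => ?_
      have h2 := (hS i k r c).mul ((tendsto_pi_nhds.1 (hω k.1)) c)
      simp only [_root_.Pi.zero_apply, mul_zero] at h2
      refine h2.congr fun t => ?_
      have h3 : Real.exp (ε * t) * Real.exp (-ε * t) = 1 := by
        rw [← Real.exp_add, neg_mul, add_neg_cancel, Real.exp_zero]
      rw [_root_.Pi.smul_apply, smul_eq_mul]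
      linear_combination (Sh t i k r c - M.S k.1 r c) * ω t k.1 c * h3

end Trajectory

/-! ### Containment -/

theorem reference_eq (w : Fin m → Fin q → ℝ) (i : Fin n) :
    M.reference w i = ∑ k, M.G.nli i k • (M.D k *ᵥ w k) :=
  rowKron_mul_blkDiag_mulVec _ _ _

/-- The leaders that do not influence a follower have level of influence zero, so the reference is
the same over all the leaders as over the influential ones. -/
theorem stackedError_stateC_apply (hacyclic : M.G.Acyclic)
    (hin : ∀ i : Fin n, ∃ u, M.G.Edge u (Sum.inl i)) (w : Fin m → Fin q → ℝ)
    (x : ∀ i, Fin (M.dimX i) → ℝ) (η : ∀ i, M.G.infLeaders i → Fin q → ℝ) (i : Fin n) (r : Fin Q) :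
    M.stackedError (M.stateC x η) (M.Omega w) ⟨i, r⟩ = (M.C i *ᵥ x i - M.reference w i) r := by
  have h1 : ∑ k : M.G.infLeaders i, M.G.nli i k.1 • (M.D k.1 *ᵥ w k.1) = M.reference w i := by
    rw [reference_eq, Finset.sum_coe_sort (M.G.infLeaders i)
      fun k => M.G.nli i k • (M.D k *ᵥ w k)]
    refine Finset.sum_subset (Finset.subset_univ _) fun k _ hk => ?_
    rw [hacyclic.nli_eq_zero hin hk, zero_smul]
  rw [stackedError, CC, DC, Matrix.fromCols_mulVec, Matrix.zero_mulVec, add_zero,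
    ← Matrix.blockDiagonal'_mul, Matrix.neg_mulVec, Pi.add_apply, Pi.neg_apply,
    blockDiagonal'_mulVec_apply, blockDiagonal'_mulVec_apply, nliKron, DR,
    rowKron_mul_blkDiag_mulVec, Pi.sub_apply, ← h1, sub_eq_add_neg]
  rfl

theorem reference_mem_convexHull (hacyclic : M.G.Acyclic)
    (hin : ∀ i : Fin n, ∃ u, M.G.Edge u (Sum.inl i)) (w : Fin m → Fin q → ℝ) (i : Fin n) :
    (WithLp.toLp 2 (M.reference w i) : EuclideanSpace ℝ (Fin Q)) ∈
      convexHull ℝ (Set.range fun k : Fin m =>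
        (WithLp.toLp 2 (M.D k *ᵥ w k) : EuclideanSpace ℝ (Fin Q))) := by
  have h1 : (WithLp.toLp 2 (M.reference w i) : EuclideanSpace ℝ (Fin Q)) =
      ∑ k, M.G.nli i k • (WithLp.toLp 2 (M.D k *ᵥ w k) : EuclideanSpace ℝ (Fin Q)) := by
    rw [reference_eq, WithLp.toLp_sum]
    rfl
  rw [h1]
  exact (convex_convexHull ℝ _).sum_mem (fun k _ => hacyclic.nli_nonneg hin i k)
    (hacyclic.nli_sum hin i) fun k _ => subset_convexHull ℝ _ ⟨k, rfl⟩

end MultiAgentSystem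

end

theorem theorem3 {n m q Q : ℕ} (M : MultiAgentSystem n m q Q)
    -- every follower is reached by a leader, and the graph is acyclic
    (hreach : ∀ i : Fin n, ∃ k : Fin m, M.G.Reaches (Sum.inr k) (Sum.inl i))
    (hacyclic : M.G.Acyclic)
    -- the followers are stabilizable with outputs of full row rank
    (hfollowers : ∀ i, IsStabilizable (M.A i) (M.B i) ∧ (M.C i).rank = Q)
    -- the leaders are marginally stable
    (hleaders : ∀ k, IsMarginallyStable (M.S k))
    -- the regulator equations have the solutions `(Pi i, Ga i)`
    (Pi : ∀ i, Matrix (Fin (M.dimX i)) (M.G.infLeaders i × Fin q) ℝ)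
    (Ga : ∀ i, Matrix (Fin (M.dimU i)) (M.G.infLeaders i × Fin q) ℝ)
    (hreg : ∀ i, M.SolvesRegulator i (Pi i) (Ga i))
    -- the gains
    (K1 : ∀ i, Matrix (Fin (M.dimU i)) (Fin (M.dimX i)) ℝ)
    (hK1 : ∀ i, IsHurwitz (M.A i + M.B i * K1 i))
    (K2 : ∀ i, Matrix (Fin (M.dimU i)) (M.G.infLeaders i × Fin q) ℝ)
    (hK2 : ∀ i, K2 i = Ga i - K1 i * Pi i)
    (βη βS βD : ℝ) (hβη : 0 < βη) (hβS : 0 < βS) (hβD : 0 < βD) :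
    -- the algorithms stop and return the data that the protocol uses
    (∀ i, (∃ k, M.G.Stops1 i k) ∧ (∃ k, M.G.Stops2 i k) ∧
      ∀ k k', M.G.Stops1 i k → M.G.Stops2 i k' →
        M.G.followersIter k i = M.G.infFollowers i ∧
        M.G.leadersIter k i = M.G.infLeaders i ∧
        M.G.edgesIter k' i = M.G.infEdges i ∧
        IsUnit (localL1 (M.G.followersIter k i) (M.G.leadersIter k i) (M.G.edgesIter k' i)).det ∧
        ∀ l : M.G.leadersIter k i,
          localNLI (M.G.followersIter k i) (M.G.leadersIter k i) (M.G.edgesIter k' i) i () l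
            = M.G.nli i l.1) ∧
    -- the closed-loop matrix is Hurwitz
    IsHurwitz (M.AC K1 K2 βη) ∧
    -- the error of the closed loop with converged estimates of the leaders' dynamics vanishes
    (∀ (X : ℝ → M.IdxX ⊕ M.IdxEta → ℝ) (Ω : ℝ → M.IdxEta → ℝ),
      (∀ t, 0 ≤ t → HasDerivWithinAt Ω (M.SRstack *ᵥ Ω t) (Set.Ici 0) t) →
      (∀ t, 0 ≤ t →
        HasDerivWithinAt X (M.AC K1 K2 βη *ᵥ X t + M.BC βη *ᵥ Ω t) (Set.Ici 0) t) →
      Tendsto (fun t => M.stackedError (X t) (Ω t)) atTop (𝓝 0)) ∧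
    -- the full adaptive closed loop, from arbitrary initial conditions
    (∀ ω x η Sh Dh, M.IsTrajectory K1 K2 βη βS βD ω x η Sh Dh →
      Tendsto (fun t => M.stackedError (M.stateC (x t) (η t)) (M.Omega (ω t))) atTop (𝓝 0) ∧
      ∀ i,
        Tendsto (fun t => M.C i *ᵥ x t i - M.reference (ω t) i) atTop (𝓝 0) ∧
        Tendsto (fun t => Metric.infDist
            (WithLp.toLp 2 (M.C i *ᵥ x t i) : EuclideanSpace ℝ (Fin Q))
            (convexHull ℝ (Set.range fun k : Fin m =>
              (WithLp.toLp 2 (M.D k *ᵥ ω t k) : EuclideanSpace ℝ (Fin Q)))))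
          atTop (𝓝 0)) := by
  have hin : ∀ i : Fin n, ∃ u, M.G.Edge u (Sum.inl i) := fun i =>
    let ⟨_, hk⟩ := hreach i
    CommGraph.exists_edge_of_reaches hk
  have hAC : IsHurwitz (M.AC K1 K2 βη) :=
    MultiAgentSystem.isHurwitz_AC hacyclic hleaders hK1 K2 hβη
  refine ⟨fun i => ⟨(M.G.exists_stops i).1, (M.G.exists_stops i).2, fun k k' hk hk' => ?_⟩, hAC,
    fun X Ω hΩ hX => ?_, fun ω x η Sh Dh h => ?_⟩
  · obtain ⟨hF, hL⟩ := hk.eq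
    have hE := hk'.eq hin
    refine ⟨hF, hL, hE, ?_⟩
    generalize M.G.followersIter k i = NA at hF ⊢
    generalize M.G.leadersIter k i = NL at hL ⊢
    generalize M.G.edgesIter k' i = E at hE ⊢
    subst hF hL hE
    exact ⟨(Matrix.isUnit_iff_isUnit_det _).1 (hacyclic.isUnit_localL1 hin i),
      hacyclic.localNLI_eq hin i⟩
  · refine MultiAgentSystem.tendsto_stackedError hreg hK2 hAC (P := fun _ => 0) hΩ
      (fun t ht => (hX t ht).congr_deriv ?_) tendsto_const_nhds ?_
    · rw [Matrix.zero_mulVec, add_zero]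
    · simp only [Matrix.zero_mulVec]
      exact tendsto_const_nhds
  · have hE := h.tendsto_stackedError hacyclic hleaders hreg hK2 hAC hβS
    have hy : ∀ i, Tendsto (fun t => M.C i *ᵥ x t i - M.reference (ω t) i) atTop (𝓝 0) :=
      fun i => tendsto_pi_nhds.2 fun r => by
        simpa only [MultiAgentSystem.stackedError_stateC_apply hacyclic hin,
          _root_.Pi.zero_apply] using
          (tendsto_pi_nhds.1 hE) ⟨i, r⟩
    refine ⟨hE, fun i => ⟨hy i, ?_⟩⟩
    have h1 : Tendsto (fun t => ‖(WithLp.toLp 2 (M.C i *ᵥ x t i - M.reference (ω t) i) :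
        EuclideanSpace ℝ (Fin Q))‖) atTop (𝓝 0) := by
      have h2 := ((PiLp.continuous_toLp 2 fun _ : Fin Q => ℝ).tendsto 0).comp (hy i)
      simpa [Function.comp_def] using h2.norm
    refine squeeze_zero (fun _ => Metric.infDist_nonneg) (fun t => ?_) h1
    refine (Metric.infDist_le_dist_of_mem
      (MultiAgentSystem.reference_mem_convexHull hacyclic hin (ω t) i)).trans_eq ?_
    rw [dist_eq_norm, WithLp.toLp_sub]
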